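/- **Notation.** Let $\mathbf O$ be the real octonions with basis $e_0=1,e_1,\dots,e_7$, where $e_i^2=-1$ for $i\ge 1$, $e_ie_j=-e_je_i$ for distinct $i,j\ge1$, and $e_le_m=e_n$, $e_me_n=e_l$, $e_ne_l=e_m$ for $(l,m,n)\in\{(1,2,3),(3,5,6),(6,7,1),(1,4,5),(3,4,7),(6,4,2),(2,5,7)\}$. Let $\overline{x}=x_0-\sum_{i\ge1}x_ie_i$ for $x=\sum_i x_ie_i$, and let $\mathbf O^{\mathbb C}=\mathbf O\otimes_{\mathbb R}\mathbb C$, with conjugation extended $\mathbb C$-linearly. For $\xi_i\in\mathbb R$ and $x_i\in\mathbf O$ put $$h^1(\xi_1,\xi_2,\xi_3;x_1,x_2,x_3)=\begin{pmatrix}\xi_1&\sqrt{-1}\,x_3&\sqrt{-1}\,\overline{x_2}\\ \sqrt{-1}\,\overline{x_3}&\xi_2&x_1\\ \sqrt{-1}\,x_2&\overline{x_1}&\xi_3\end{pmatrix}\in M(3,\mathbf O^{\mathbb C}),$$ and let $\mathcal J^1$ be the real vector space of all these matrices, with the Jordan product $X\circ Y=\tfrac12(XY+YX)$ and the identity $E=\mathrm{diag}(1,1,1)$.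 Put $\mathrm{tr}(h^1(\xi;x))=\xi_1+\xi_2+\xi_3$, $(X|Y)=\mathrm{tr}(X\circ Y)$, $$X\times Y=\tfrac12\bigl(2X\circ Y-\mathrm{tr}(X)Y-\mathrm{tr}(Y)X+(\mathrm{tr}(X)\mathrm{tr}(Y)-(X|Y))E\bigr),\qquad X^{\times2}=X\times X,\qquad \det(X)=\tfrac13(X|X^{\times2}).$$ Let $\mathrm F_{4(-20)}=\{g\in \mathrm{GL}_{\mathbb R}(\mathcal J^1)\mid g(X\circ Y)=gX\circ gY \text{ for all } X,Y\in\mathcal J^1\}$, and for $X\in\mathcal J^1$ let $Orb(X)=\{gX\mid g\in \mathrm F_{4(-20)}\}$. Let $E_1=\mathrm{diag}(1,0,0)$, $E_2=\mathrm{diag}(0,1,0)$, $E_3=\mathrm{diag}(0,0,1)$, $P^+=h^1(1,-1,0;0,0,1)$, $P^-=h^1(-1,1,0;0,0,1)$ and $Q^+(x)=h^1(0,0,0;x,\overline x,0)$ for $x\in\mathbf O$. The exceptional hyperbolic planes are $$\mathcal H(\mathbf O)=\{X\in\mathcal J^1\mid X^{\times2}=0,\ \mathrm{tr}(X)=1,\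 (X|E_1)\ge1\},\qquad \mathcal H'(\mathbf O)=\{X\in\mathcal J^1\mid X^{\times2}=0,\ \mathrm{tr}(X)=1,\ (X|E_1)\le0\},$$ and the exceptional null cones are $$\mathcal N_1^+(\mathbf O)=\{X\in\mathcal J^1\mid X^{\times2}=0,\ \mathrm{tr}(X)=0,\ (X|E_1)>0\},\qquad \mathcal N_1^-(\mathbf O)=\{X\in\mathcal J^1\mid X^{\times2}=0,\ \mathrm{tr}(X)=0,\ (X|E_1)<0\},$$ $$\mathcal N_2(\mathbf O)=\{X\in\mathcal J^1\mid \mathrm{tr}(X)=\mathrm{tr}(X^{\times2})=\det(X)=0,\ X^{\times2}\ne0\}.$$ **Proposition.** Each of these five sets is a single $\mathrm F_{4(-20)}$-orbit. Specifically: (a) $\mathcal H(\mathbf O)=Orb(E_1)$; (b) $\mathcal H'(\mathbf O)=Orb(E_2)=Orb(E_3)$; (c) $\mathcal N_1^+(\mathbf O)=Orb(P^+)$; (d) $\mathcal N_1^-(\mathbf O)=Orb(P^-)$; (e) $\mathcal N_2(\mathbf O)=Orb(Q^+(1))$. -/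

import Mathlib

namespace ExcJordan

noncomputable section

/-- The octonions with coefficients in `R`: the element with coordinates `x` is `∑ i, x i e_i`,
where `e_0 = 1`. For `R = ℝ` this is `𝐎`, for `R = ℂ` its complexification. -/
@[ext] structure Octonion (R : Type*) where
  /-- The coordinates with respect to `e_0 = 1, e_1, …, e_7`. -/
  coord : Fin 8 → R

namespace Octonion

instance instZero {R : Type*} [AddCommGroup R] : Zero (Octonion R) := ⟨⟨0⟩⟩
instance instAdd {R : Type*} [AddCommGroup R] : Add (Octonion R) :=
  ⟨fun x y => ⟨x.coord + y.coord⟩⟩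
instance instNeg {R : Type*} [AddCommGroup R] : Neg (Octonion R) := ⟨fun x => ⟨-x.coord⟩⟩
instance instSub {R : Type*} [AddCommGroup R] : Sub (Octonion R) :=
  ⟨fun x y => ⟨x.coord - y.coord⟩⟩
instance instSMul {S R : Type*} [SMul S R] : SMul S (Octonion R) := ⟨fun s x => ⟨s • x.coord⟩⟩

theorem coord_injective {R : Type*} : Function.Injective (coord : Octonion R → Fin 8 → R) :=
  fun _ _ h => Octonion.ext h

instance instAddCommGroup {R : Type*} [AddCommGroup R] : AddCommGroup (Octonion R) :=
  coord_injective.addCommGroup coord rfl (fun _ _ => rfl) (fun _ => rfl) (fun _ _ => rfl)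
    (fun _ _ => rfl) (fun _ _ => rfl)

/-- The coordinates as an additive map. -/
def coordHom (R : Type*) [AddCommGroup R] : Octonion R →+ (Fin 8 → R) where
  toFun := coord
  map_zero' := rfl
  map_add' _ _ := rfl

instance instModule {S R : Type*} [Semiring S] [AddCommGroup R] [Module S R] :
    Module S (Octonion R) :=
  coord_injective.module S (coordHom R) (fun _ _ => rfl)

/-- The triples `(l, m, n)` with `e_l e_m = e_n`, `e_m e_n = e_l` and `e_n e_l = e_m`. -/
def triples : List (Fin 8 × Fin 8 × Fin 8) :=
  [(1, 2, 3), (3, 5, 6), (6, 7, 1), (1, 4, 5), (3, 4, 7), (6, 4, 2), (2, 5, 7)]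

/-- `(i, j, k)` is a cyclic rotation of one of the triples, so that `e_i e_j = e_k`. -/
abbrev IsCyclicTriple (i j k : Fin 8) : Prop :=
  (i, j, k) ∈ triples ∨ (j, k, i) ∈ triples ∨ (k, i, j) ∈ triples

/-- The coefficient of `e_k` in the product `e_i e_j`. -/
def structConst (i j k : Fin 8) : ℤ :=
  if i = 0 then (if j = k then 1 else 0)
  else if j = 0 then (if i = k then 1 else 0)
  else if i = j then (if k = 0 then -1 else 0)
  else if IsCyclicTriple i j k then 1
  else if IsCyclicTriple j i k then -1
  else 0

instance instOne {R : Type*} [CommRing R] : One (Octonion R) :=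
  ⟨⟨fun k => if k = 0 then 1 else 0⟩⟩

instance instMul {R : Type*} [CommRing R] : Mul (Octonion R) :=
  ⟨fun x y => ⟨fun k => ∑ i : Fin 8, ∑ j : Fin 8,
    (structConst i j k : R) * (x.coord i * y.coord j)⟩⟩

/-- Octonion conjugation `x_0 - ∑_{i ≥ 1} x_i e_i` (linear over the coefficients). -/
def conj {R : Type*} [CommRing R] (x : Octonion R) : Octonion R :=
  ⟨fun i => if i = 0 then x.coord i else -x.coord i⟩

/-- The inclusion of the real octonions into their complexification. -/
def toComplex (x : Octonion ℝ) : Octonion ℂ := ⟨fun i => (x.coord i : ℂ)⟩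

/-- The complex conjugation of the complexified octonions with respect to the real ones. -/
def tau (x : Octonion ℂ) : Octonion ℂ := ⟨fun i => (starRingEnd ℂ) (x.coord i)⟩

/-! Coordinates -/

theorem ext_coord {R : Type*} {x y : Octonion R} (h : ∀ i, x.coord i = y.coord i) : x = y :=
  Octonion.ext (funext h)

@[simp] theorem coord_add {R : Type*} [AddCommGroup R] (x y : Octonion R) (i : Fin 8) :
    (x + y).coord i = x.coord i + y.coord i := rfl

@[simp] theorem coord_zero {R : Type*} [AddCommGroup R] (i : Fin 8) :
    (0 : Octonion R).coord i = 0 := rfl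

@[simp] theorem coord_neg {R : Type*} [AddCommGroup R] (x : Octonion R) (i : Fin 8) :
    (-x).coord i = -x.coord i := rfl

@[simp] theorem coord_smul {S R : Type*} [Semiring S] [AddCommGroup R] [Module S R]
    (s : S) (x : Octonion R) (i : Fin 8) : (s • x).coord i = s • x.coord i := rfl

theorem coord_one {R : Type*} [CommRing R] (i : Fin 8) :
    (1 : Octonion R).coord i = if i = 0 then 1 else 0 := rfl

theorem coord_mul {R : Type*} [CommRing R] (x y : Octonion R) (k : Fin 8) :
    (x * y).coord k = ∑ i : Fin 8, ∑ j : Fin 8,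
      (structConst i j k : R) * (x.coord i * y.coord j) := rfl

theorem coord_conj {R : Type*} [CommRing R] (x : Octonion R) (i : Fin 8) :
    (conj x).coord i = if i = 0 then x.coord i else -x.coord i := rfl

theorem coord_toComplex (x : Octonion ℝ) (i : Fin 8) :
    (toComplex x).coord i = (x.coord i : ℂ) := rfl

theorem coord_tau (x : Octonion ℂ) (i : Fin 8) :
    (tau x).coord i = (starRingEnd ℂ) (x.coord i) := rfl

/-! Compatibility of the two conjugations with the operations -/

/-- The sign by which conjugation acts on `e_i`. -/
def sgn (i : Fin 8) : ℤ := if i = 0 then 1 else -1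

theorem structConst_swap :
    ∀ i j k : Fin 8, sgn k * structConst i j k = structConst j i k * (sgn i * sgn j) := by
  decide

theorem coord_conj_eq_sgn {R : Type*} [CommRing R] (x : Octonion R) (i : Fin 8) :
    (conj x).coord i = (sgn i : R) * x.coord i := by
  rw [coord_conj]; unfold sgn; split <;> simp

theorem conj_mul {R : Type*} [CommRing R] (x y : Octonion R) :
    conj (x * y) = conj y * conj x := by
  refine ext_coord fun k => ?_
  rw [coord_conj_eq_sgn, coord_mul, coord_mul, Finset.sum_comm, Finset.mul_sum]
  refine Finset.sum_congr rfl fun j _ => ?_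
  rw [Finset.mul_sum]
  refine Finset.sum_congr rfl fun i _ => ?_
  have h : ((sgn k * structConst i j k : ℤ) : R) =
      ((structConst j i k * (sgn i * sgn j) : ℤ) : R) := by rw [structConst_swap]
  push_cast at h
  rw [coord_conj_eq_sgn, coord_conj_eq_sgn]
  linear_combination (x.coord i * y.coord j) * h

theorem conj_add {R : Type*} [CommRing R] (x y : Octonion R) :
    conj (x + y) = conj x + conj y := by
  refine ext_coord fun k => ?_
  simp only [coord_conj, coord_add]; split <;> ring

theorem conj_conj {R : Type*} [CommRing R] (x : Octonion R) : conj (conj x) = x := by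
  refine ext_coord fun k => ?_
  simp only [coord_conj]; split <;> simp

theorem conj_neg {R : Type*} [CommRing R] (x : Octonion R) : conj (-x) = -conj x := by
  refine ext_coord fun k => ?_
  simp only [coord_conj, coord_neg]; split <;> simp

theorem conj_zero {R : Type*} [CommRing R] : conj (0 : Octonion R) = 0 := by
  refine ext_coord fun k => ?_
  simp [coord_conj]

theorem conj_one {R : Type*} [CommRing R] : conj (1 : Octonion R) = 1 := by
  refine ext_coord fun k => ?_
  simp only [coord_conj, coord_one]; split <;> simp_all

theorem conj_smul {S R : Type*} [Semiring S] [CommRing R] [Module S R] (s : S)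
    (x : Octonion R) : conj (s • x) = s • conj x := by
  refine ext_coord fun k => ?_
  simp only [coord_conj, coord_smul]; split <;> simp

theorem conj_toComplex (x : Octonion ℝ) : conj (toComplex x) = toComplex (conj x) := by
  refine ext_coord fun k => ?_
  simp only [coord_conj, coord_toComplex]; split <;> simp

theorem tau_mul (x y : Octonion ℂ) : tau (x * y) = tau x * tau y := by
  refine ext_coord fun k => ?_
  simp [coord_tau, coord_mul, map_sum]

theorem tau_add (x y : Octonion ℂ) : tau (x + y) = tau x + tau y := by
  refine ext_coord fun k => ?_
  simp [coord_tau]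

theorem tau_neg (x : Octonion ℂ) : tau (-x) = -tau x := by
  refine ext_coord fun k => ?_
  simp [coord_tau]

theorem tau_zero : tau 0 = 0 := by
  refine ext_coord fun k => ?_
  simp [coord_tau]

theorem tau_one : tau 1 = 1 := by
  refine ext_coord fun k => ?_
  simp only [coord_tau, coord_one]; split <;> simp

theorem tau_smul (r : ℝ) (x : Octonion ℂ) : tau (r • x) = r • tau x := by
  refine ext_coord fun k => ?_
  simp [coord_tau]

theorem tau_csmul (c : ℂ) (x : Octonion ℂ) : tau (c • x) = (starRingEnd ℂ) c • tau x := by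
  refine ext_coord fun k => ?_
  simp [coord_tau]

theorem tau_toComplex (x : Octonion ℝ) : tau (toComplex x) = toComplex x := by
  refine ext_coord fun k => ?_
  simp [coord_tau, coord_toComplex]

theorem neg_mul' {R : Type*} [CommRing R] (x y : Octonion R) : -x * y = -(x * y) := by
  refine ext_coord fun k => ?_
  simp [coord_mul]

theorem mul_neg' {R : Type*} [CommRing R] (x y : Octonion R) : x * -y = -(x * y) := by
  refine ext_coord fun k => ?_
  simp [coord_mul]

end Octonion

open Octonion

/-- `M(3, 𝐎^ℂ)`. -/
abbrev Mat : Type := Matrix (Fin 3) (Fin 3) (Octonion ℂ)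

/-- `A^*`, the transpose of the octonion-conjugate matrix. -/
def adj (A : Mat) : Mat := fun i j => conj (A j i)

/-- The entrywise action of `τ`. -/
def tauMat (A : Mat) : Mat := fun i j => tau (A i j)

/-- `σ h(ξ₁, ξ₂, ξ₃; x₁, x₂, x₃) = h(ξ₁, ξ₂, ξ₃; x₁, -x₂, -x₃)`: the off-diagonal entries of the
first row and of the first column change sign. -/
def sigmaMat (A : Mat) : Mat :=
  !![A 0 0, -A 0 1, -A 0 2;
     -A 1 0, A 1 1, A 1 2;
     -A 2 0, A 2 1, A 2 2]

/-- The product `2⁻¹ (A B + B A)` of matrices. -/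
def jordanMat (A B : Mat) : Mat := (2⁻¹ : ℝ) • (A * B + B * A)

/-- The exceptional Jordan algebra `𝒥¹`: the Hermitian `3 × 3` matrices over `𝐎^ℂ` (the elements
of `𝒥^ℂ`) that are fixed by `τ σ`. -/
def J1 : Submodule ℝ Mat where
  carrier := {A | adj A = A ∧ tauMat (sigmaMat A) = A}
  add_mem' := by
    rintro A B ⟨hA, hA'⟩ ⟨hB, hB'⟩
    refine ⟨?_, ?_⟩
    · conv_rhs => rw [← hA, ← hB]
      funext i j
      exact conj_add _ _
    · conv_rhs => rw [← hA', ← hB']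
      funext i j
      fin_cases i <;> fin_cases j <;>
        simp [tauMat, sigmaMat, ← tau_add, add_comm]
  zero_mem' := by
    refine ⟨?_, ?_⟩
    · funext i j; exact conj_zero
    · funext i j
      fin_cases i <;> fin_cases j <;> simp [tauMat, sigmaMat, tau_zero]
  smul_mem' := by
    rintro r A ⟨hA, hA'⟩
    refine ⟨?_, ?_⟩
    · conv_rhs => rw [← hA]
      funext i j
      exact conj_smul _ _
    · conv_rhs => rw [← hA']
      funext i j
      fin_cases i <;> fin_cases j <;>
        simp [tauMat, sigmaMat, ← tau_smul]

theorem mem_J1 {A : Mat} : A ∈ J1 ↔ adj A = A ∧ tauMat (sigmaMat A) = A := Iff.rfl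

theorem adj_mul (A B : Mat) : adj (A * B) = adj B * adj A := by
  funext i j
  simp only [adj, Matrix.mul_apply, Fin.sum_univ_three, conj_add, Octonion.conj_mul]

theorem sigmaMat_mul (A B : Mat) : sigmaMat (A * B) = sigmaMat A * sigmaMat B := by
  funext i j
  fin_cases i <;> fin_cases j <;>
    simp [sigmaMat, Matrix.mul_apply, Fin.sum_univ_three, neg_mul', mul_neg'] <;> abel

theorem tauMat_mul (A B : Mat) : tauMat (A * B) = tauMat A * tauMat B := by
  funext i j
  simp only [tauMat, Matrix.mul_apply, Fin.sum_univ_three, tau_add, tau_mul]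

theorem jordanMat_mem {A B : Mat} (hA : A ∈ J1) (hB : B ∈ J1) : jordanMat A B ∈ J1 := by
  have h1 : adj (A * B + B * A) = A * B + B * A := by
    have : adj (A * B + B * A) = adj (A * B) + adj (B * A) := by
      funext i j; exact conj_add _ _
    rw [this, adj_mul, adj_mul, hA.1, hB.1, add_comm]
  have h2 : tauMat (sigmaMat (A * B + B * A)) = A * B + B * A := by
    have : tauMat (sigmaMat (A * B + B * A)) =
        tauMat (sigmaMat (A * B)) + tauMat (sigmaMat (B * A)) := by
      funext i j
      fin_cases i <;> fin_cases j <;> simp [tauMat, sigmaMat, ← tau_add, add_comm]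
    rw [this, sigmaMat_mul, sigmaMat_mul, tauMat_mul, tauMat_mul, hA.2, hB.2]
  exact J1.smul_mem _ ⟨h1, h2⟩

/-- The matrix `h¹(ξ₁, ξ₂, ξ₃; x₁, x₂, x₃)`. -/
def h1Mat (ξ₁ ξ₂ ξ₃ : ℝ) (x₁ x₂ x₃ : Octonion ℝ) : Mat :=
  !![ξ₁ • 1, Complex.I • toComplex x₃, Complex.I • toComplex (conj x₂);
     Complex.I • toComplex (conj x₃), ξ₂ • 1, toComplex x₁;
     Complex.I • toComplex x₂, toComplex (conj x₁), ξ₃ • 1]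

theorem h1Mat_mem (ξ₁ ξ₂ ξ₃ : ℝ) (x₁ x₂ x₃ : Octonion ℝ) :
    h1Mat ξ₁ ξ₂ ξ₃ x₁ x₂ x₃ ∈ J1 := by
  refine ⟨?_, ?_⟩
  · funext i j
    fin_cases i <;> fin_cases j <;>
      simp [adj, h1Mat, conj_smul, conj_one, conj_toComplex, conj_conj]
  · funext i j
    fin_cases i <;> fin_cases j <;>
      simp [tauMat, sigmaMat, h1Mat, tau_neg, tau_csmul, tau_smul, tau_one, tau_toComplex]

/-- The set of the matrices `h¹(ξ; x)` is all of `𝒥¹`. -/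
theorem mem_J1_iff_exists {A : Mat} : A ∈ J1 ↔
    ∃ (ξ₁ ξ₂ ξ₃ : ℝ) (x₁ x₂ x₃ : Octonion ℝ), A = h1Mat ξ₁ ξ₂ ξ₃ x₁ x₂ x₃ := by
  refine ⟨fun h => ?_, ?_⟩
  · have hc : ∀ i j, conj (A j i) = A i j := fun i j => congrFun (congrFun h.1 i) j
    have hd : ∀ i k, k ≠ 0 → (A i i).coord k = 0 := by
      intro i k hk
      have := congrArg (fun z => z.coord k) (hc i i)
      rw [coord_conj, if_neg hk] at this
      exact self_eq_neg.mp this.symm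
    have ht : ∀ i j, tauMat (sigmaMat A) i j = A i j := fun i j => congrFun (congrFun h.2 i) j
    have hdiag : ∀ i, tau (A i i) = A i i → A i i = ((A i i).coord 0).re • 1 := by
      intro i hi
      refine ext_coord fun k => ?_
      rw [coord_smul, coord_one]
      by_cases hk : k = 0
      · subst hk
        have := congrArg (fun z => z.coord 0) hi
        rw [coord_tau] at this
        simp [Complex.conj_eq_iff_re.mp this]
      · simp [hk, hd i k hk]
    have hreal : ∀ i j, tau (A i j) = A i j → A i j = toComplex (⟨fun k => ((A i j).coord k).re⟩) := by
      intro i j hij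
      refine ext_coord fun k => ?_
      have := congrArg (fun z => z.coord k) hij
      rw [coord_tau] at this
      exact (Complex.conj_eq_iff_re.mp this).symm
    have himag : ∀ i j, tau (-A i j) = A i j →
        A i j = Complex.I • toComplex (⟨fun k => ((A i j).coord k).im⟩) := by
      intro i j hij
      refine ext_coord fun k => ?_
      have := congrArg (fun z => z.coord k) hij
      rw [coord_tau, coord_neg] at this
      have hre := congrArg Complex.re this
      simp only [map_neg, Complex.neg_re, Complex.conj_re] at hre
      rw [coord_smul]
      apply Complex.ext <;> simp [coord_toComplex]
      linarith
    have h01 := himag 0 1 (ht 0 1)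
    have h20 := himag 2 0 (ht 2 0)
    have h12 := hreal 1 2 (ht 1 2)
    refine ⟨((A 0 0).coord 0).re, ((A 1 1).coord 0).re, ((A 2 2).coord 0).re, ⟨fun k => ((A 1 2).coord k).re⟩,
      ⟨fun k => ((A 2 0).coord k).im⟩, ⟨fun k => ((A 0 1).coord k).im⟩, ?_⟩
    funext i j
    fin_cases i <;> fin_cases j
    · exact hdiag 0 (ht 0 0)
    · exact h01
    · change A 0 2 = Complex.I • toComplex (conj _)
      rw [← conj_toComplex, ← conj_smul, ← h20, hc]
    · change A 1 0 = Complex.I • toComplex (conj _)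
      rw [← conj_toComplex, ← conj_smul, ← h01, hc]
    · exact hdiag 1 (ht 1 1)
    · exact h12
    · exact h20
    · change A 2 1 = toComplex (conj _)
      rw [← conj_toComplex, ← h12, hc]
    · exact hdiag 2 (ht 2 2)
  · rintro ⟨ξ₁, ξ₂, ξ₃, x₁, x₂, x₃, rfl⟩
    exact h1Mat_mem _ _ _ _ _ _

/-- `h¹(ξ₁, ξ₂, ξ₃; x₁, x₂, x₃)` as an element of `𝒥¹`. -/
def h1 (ξ₁ ξ₂ ξ₃ : ℝ) (x₁ x₂ x₃ : Octonion ℝ) : J1 :=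
  ⟨h1Mat ξ₁ ξ₂ ξ₃ x₁ x₂ x₃, h1Mat_mem ξ₁ ξ₂ ξ₃ x₁ x₂ x₃⟩

/-- The Jordan product `X ∘ Y = 2⁻¹ (X Y + Y X)` of `𝒥¹`. -/
def jordan (X Y : J1) : J1 := ⟨jordanMat X Y, jordanMat_mem X.2 Y.2⟩

/-- The identity element `E = diag(1, 1, 1)`. -/
def E : J1 := h1 1 1 1 0 0 0

/-- `E₁ = diag(1, 0, 0)`. -/
def E₁ : J1 := h1 1 0 0 0 0 0

/-- `E₂ = diag(0, 1, 0)`. -/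
def E₂ : J1 := h1 0 1 0 0 0 0

/-- `E₃ = diag(0, 0, 1)`. -/
def E₃ : J1 := h1 0 0 1 0 0 0

/-- `P⁺`. -/
def Pplus : J1 := h1 1 (-1) 0 0 0 1

/-- `P⁻`. -/
def Pminus : J1 := h1 (-1) 1 0 0 0 1

/-- `Q⁺(x)`. -/
def Qplus (x : Octonion ℝ) : J1 := h1 0 0 0 x (conj x) 0

/-- The trace: the diagonal entries of an element of `𝒥¹` are real multiples `ξᵢ` of the unit of
the octonions, and the trace is `ξ₁ + ξ₂ + ξ₃`. -/
def tr (X : J1) : ℝ := ∑ i : Fin 3, (((X : Mat) i i).coord 0).re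

theorem tr_h1 (ξ₁ ξ₂ ξ₃ : ℝ) (x₁ x₂ x₃ : Octonion ℝ) :
    tr (h1 ξ₁ ξ₂ ξ₃ x₁ x₂ x₃) = ξ₁ + ξ₂ + ξ₃ := by
  simp [tr, h1, h1Mat, Fin.sum_univ_three, coord_one]

/-- The inner product `(X|Y) = tr(X ∘ Y)`. -/
def ip (X Y : J1) : ℝ := tr (jordan X Y)

/-- Freudenthal's cross product `X × Y`. -/
def cross (X Y : J1) : J1 :=
  (2⁻¹ : ℝ) • ((2 : ℝ) • jordan X Y - tr X • Y - tr Y • X + (tr X * tr Y - ip X Y) • E)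

/-- The determinant `3⁻¹ (X|X × X)`. -/
def det (X : J1) : ℝ := 3⁻¹ * ip X (cross X X)

/-- The linear Lie group `F₄₍₋₂₀₎`: the automorphism group of the Jordan algebra `𝒥¹`. -/
def F4 : Subgroup (J1 ≃ₗ[ℝ] J1) where
  carrier := {g | ∀ X Y : J1, g (jordan X Y) = jordan (g X) (g Y)}
  mul_mem' := by
    intro g h hg hh X Y
    rw [LinearEquiv.mul_apply, LinearEquiv.mul_apply, LinearEquiv.mul_apply, hh, hg]
  one_mem' := fun _ _ => rfl
  inv_mem' := by
    intro g hg X Y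
    apply g.injective
    have h : ∀ Z : J1, g (g⁻¹ Z) = Z := fun Z => g.apply_symm_apply Z
    rw [hg, h, h, h]

/-- The `F₄₍₋₂₀₎`-orbit `{g X | g ∈ F₄₍₋₂₀₎}`. -/
def Orb (X : J1) : Set J1 := {Y | ∃ g ∈ F4, Y = g X}

/-- The exceptional hyperbolic plane `ℋ(𝐎)`. -/
def H : Set J1 := {X | cross X X = 0 ∧ tr X = 1 ∧ 1 ≤ ip X E₁}

/-- The exceptional hyperbolic plane `ℋ'(𝐎)`. -/
def H' : Set J1 := {X | cross X X = 0 ∧ tr X = 1 ∧ ip X E₁ ≤ 0}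

/-- The exceptional null cone `𝒩₁⁺(𝐎)`. -/
def N1plus : Set J1 := {X | cross X X = 0 ∧ tr X = 0 ∧ 0 < ip X E₁}

/-- The exceptional null cone `𝒩₁⁻(𝐎)`. -/
def N1minus : Set J1 := {X | cross X X = 0 ∧ tr X = 0 ∧ ip X E₁ < 0}

/-- The exceptional null cone `𝒩₂(𝐎)`. -/
def N2 : Set J1 := {X | tr X = 0 ∧ tr (cross X X) = 0 ∧ det X = 0 ∧ cross X X ≠ 0}

end

end ExcJordan

/-!
# Orbits of `F₄₍₋₂₀₎` on rank-one and nilpotent elements of the exceptional Jordan algebra `𝒥¹`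

The group elements that carry out all but one of the moves are *Peirce reflections*. For a primitive
idempotent `P` (that is, `P^{×2} = 0` and `tr P = 1`) the map `X ↦ X - 4 P ∘ X + 4 (P|X) P` is an
automorphism (`reflectionMap_jordan`). The proof linearises two identities in the direction `P`:
`X ∘ X^{×2} = det(X) E` (`jordan_sharp`) and `(X^{×2})^{×2} = det(X) X` (`sharp_sharp`). These are
checked in octonion coordinates, where they amount to the multiplicativity of the norm,
alternativity and the middle Moufang identity.

If `X` and `Y` are of rank one, of the same trace `t ≥ 0`, and `(X|Y) > 0`, then the "midpoint" of
`X` and `Y` is a primitive idempotent whose reflection exchanges them (`exists_mem_F4_of_ip_pos`).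
This brings every point of `ℋ` to `E₁`, every point of `ℋ'` to `E₂` or `E₃`, and every element of
`𝒩₁⁺` to `P⁺` or to `-P⁻`, which is itself exchanged with `P⁺`. Negation then treats `𝒩₁⁻`.

For `X` in `𝒩₂` the element `X^{×2}` is of rank one and trace zero, so that it can be moved to `P⁺`
or `P⁻`. Together with `X ∘ X^{×2} = 0` this excludes `P⁺` and forces `X = Q⁺(x) + r P⁻` with
`|x| = 1` (`eq_Qplus_add_of_sharp_eq`). The triality automorphisms
`h¹(ξ; x₁, x₂, x₃) ↦ h¹(ξ; ā x₁, x₂ a, a x₃ ā)` with `a` an imaginary unit fix `P⁻` and reduce to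
`x = 1`, and one more reflection removes `r P⁻`.

Conversely, the five sets are invariant. The trace of the multiplication by `X` is `9 tr X`
(`trace_jordanLeft`), hence every automorphism preserves the trace, the inner product, the cross
product and the determinant. It remains to see that the conditions on `(X|E₁)` are invariant: the
orbits of `E₁` and `E₂` differ because the trace form is positive on the Peirce space `J_0(E₁)` and
not on `J_0(E₂)`, and the sign of `(X|Y)` for `X` null and `Y` in `ℋ` does not depend on `Y` since
this pairing does not vanish and `ℋ` is connected (`ip_E₁_pos_of_ip_pos`).
-/

namespace ExcJordan

namespace Octonion

/-! ### Octonion algebra -/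

theorem ext_coords {R : Type*} {x y : Octonion R}
    (h0 : x.coord 0 = y.coord 0) (h1 : x.coord 1 = y.coord 1)
    (h2 : x.coord 2 = y.coord 2) (h3 : x.coord 3 = y.coord 3) (h4 : x.coord 4 = y.coord 4)
    (h5 : x.coord 5 = y.coord 5) (h6 : x.coord 6 = y.coord 6) (h7 : x.coord 7 = y.coord 7) :
    x = y :=
  ext_coord fun k => by fin_cases k <;> assumption

section Ring

variable {R : Type*} [CommRing R]

instance instNonUnitalNonAssocRing : NonUnitalNonAssocRing (Octonion R) :=
  { instAddCommGroup, instMul with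
    left_distrib := fun x y z => ext_coord fun k => by
      simp [coord_mul, mul_add, Finset.sum_add_distrib]
    right_distrib := fun x y z => ext_coord fun k => by
      simp [coord_mul, add_mul, mul_add, Finset.sum_add_distrib]
    zero_mul := fun x => ext_coord fun k => by simp [coord_mul]
    mul_zero := fun x => ext_coord fun k => by simp [coord_mul] }

theorem smul_mul_eq {S : Type*} [CommRing S] [Algebra S R] (s : S) (x y : Octonion R) :
    s • x * y = s • (x * y) :=
  ext_coord fun k => by simp [coord_mul, Finset.smul_sum]

theorem mul_smul_eq {S : Type*} [CommRing S] [Algebra S R] (s : S) (x y : Octonion R) :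
    x * s • y = s • (x * y) :=
  ext_coord fun k => by simp [coord_mul, Finset.smul_sum]

theorem coord_mul_0 (x y : Octonion R) :
    (x * y).coord 0 =
      x.coord 0 * y.coord 0 - x.coord 1 * y.coord 1 - x.coord 2 * y.coord 2 -
      x.coord 3 * y.coord 3 - x.coord 4 * y.coord 4 - x.coord 5 * y.coord 5 -
      x.coord 6 * y.coord 6 - x.coord 7 * y.coord 7 := by
  simp [coord_mul, Fin.sum_univ_eight, structConst, IsCyclicTriple, triples]
  ring

theorem coord_mul_1 (x y : Octonion R) :
    (x * y).coord 1 =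
      x.coord 0 * y.coord 1 + x.coord 1 * y.coord 0 + x.coord 2 * y.coord 3 -
      x.coord 3 * y.coord 2 + x.coord 4 * y.coord 5 - x.coord 5 * y.coord 4 +
      x.coord 6 * y.coord 7 - x.coord 7 * y.coord 6 := by
  simp [coord_mul, Fin.sum_univ_eight, structConst, IsCyclicTriple, triples]
  ring

theorem coord_mul_2 (x y : Octonion R) :
    (x * y).coord 2 =
      x.coord 0 * y.coord 2 - x.coord 1 * y.coord 3 + x.coord 2 * y.coord 0 +
      x.coord 3 * y.coord 1 - x.coord 4 * y.coord 6 + x.coord 5 * y.coord 7 +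
      x.coord 6 * y.coord 4 - x.coord 7 * y.coord 5 := by
  simp [coord_mul, Fin.sum_univ_eight, structConst, IsCyclicTriple, triples]
  ring

theorem coord_mul_3 (x y : Octonion R) :
    (x * y).coord 3 =
      x.coord 0 * y.coord 3 + x.coord 1 * y.coord 2 - x.coord 2 * y.coord 1 +
      x.coord 3 * y.coord 0 + x.coord 4 * y.coord 7 + x.coord 5 * y.coord 6 -
      x.coord 6 * y.coord 5 - x.coord 7 * y.coord 4 := by
  simp [coord_mul, Fin.sum_univ_eight, structConst, IsCyclicTriple, triples]
  ring

theorem coord_mul_4 (x y : Octonion R) :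
    (x * y).coord 4 =
      x.coord 0 * y.coord 4 - x.coord 1 * y.coord 5 + x.coord 2 * y.coord 6 -
      x.coord 3 * y.coord 7 + x.coord 4 * y.coord 0 + x.coord 5 * y.coord 1 -
      x.coord 6 * y.coord 2 + x.coord 7 * y.coord 3 := by
  simp [coord_mul, Fin.sum_univ_eight, structConst, IsCyclicTriple, triples]
  ring

theorem coord_mul_5 (x y : Octonion R) :
    (x * y).coord 5 =
      x.coord 0 * y.coord 5 + x.coord 1 * y.coord 4 - x.coord 2 * y.coord 7 -
      x.coord 3 * y.coord 6 - x.coord 4 * y.coord 1 + x.coord 5 * y.coord 0 +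
      x.coord 6 * y.coord 3 + x.coord 7 * y.coord 2 := by
  simp [coord_mul, Fin.sum_univ_eight, structConst, IsCyclicTriple, triples]
  ring

theorem coord_mul_6 (x y : Octonion R) :
    (x * y).coord 6 =
      x.coord 0 * y.coord 6 - x.coord 1 * y.coord 7 - x.coord 2 * y.coord 4 +
      x.coord 3 * y.coord 5 + x.coord 4 * y.coord 2 - x.coord 5 * y.coord 3 +
      x.coord 6 * y.coord 0 + x.coord 7 * y.coord 1 := by
  simp [coord_mul, Fin.sum_univ_eight, structConst, IsCyclicTriple, triples]
  ring

theorem coord_mul_7 (x y : Octonion R) :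
    (x * y).coord 7 =
      x.coord 0 * y.coord 7 + x.coord 1 * y.coord 6 + x.coord 2 * y.coord 5 +
      x.coord 3 * y.coord 4 - x.coord 4 * y.coord 3 - x.coord 5 * y.coord 2 -
      x.coord 6 * y.coord 1 + x.coord 7 * y.coord 0 := by
  simp [coord_mul, Fin.sum_univ_eight, structConst, IsCyclicTriple, triples]
  ring

instance instMulOneClass : MulOneClass (Octonion R) :=
  { instOne, instMul with
    one_mul := fun x => by
      apply ext_coords <;>
        simp [coord_mul_0, coord_mul_1, coord_mul_2, coord_mul_3, coord_mul_4, coord_mul_5,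
          coord_mul_6, coord_mul_7, coord_one]
    mul_one := fun x => by
      apply ext_coords <;>
        simp [coord_mul_0, coord_mul_1, coord_mul_2, coord_mul_3, coord_mul_4, coord_mul_5,
          coord_mul_6, coord_mul_7, coord_one] }

end Ring

theorem toComplex_mul (x y : Octonion ℝ) : toComplex (x * y) = toComplex x * toComplex y :=
  ext_coord fun k => by simp [coord_mul, coord_toComplex]

theorem toComplex_add (x y : Octonion ℝ) : toComplex (x + y) = toComplex x + toComplex y :=
  ext_coord fun k => by simp [coord_toComplex]

theorem toComplex_neg (x : Octonion ℝ) : toComplex (-x) = -toComplex x :=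
  ext_coord fun k => by simp [coord_toComplex]

theorem toComplex_smul (r : ℝ) (x : Octonion ℝ) : toComplex (r • x) = r • toComplex x :=
  ext_coord fun k => by simp [coord_toComplex]

theorem toComplex_one : toComplex 1 = 1 :=
  ext_coord fun k => by rw [coord_toComplex, coord_one, coord_one]; split <;> simp

theorem toComplex_injective : Function.Injective toComplex := fun x y h =>
  ext_coord fun k => by
    have := congrArg (fun z => z.coord k) h
    exact Complex.ofReal_injective this

/-- The Euclidean inner product of the octonions, for which `e_0, …, e_7` is orthonormal. -/
def dot (x y : Octonion ℝ) : ℝ := ∑ i, x.coord i * y.coord i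

theorem dot_comm (x y : Octonion ℝ) : dot x y = dot y x := by
  simp only [dot, mul_comm]

theorem dot_add_left (x y z : Octonion ℝ) : dot (x + y) z = dot x z + dot y z := by
  simp [dot, add_mul, Finset.sum_add_distrib]

theorem dot_smul_left (r : ℝ) (x y : Octonion ℝ) : dot (r • x) y = r * dot x y := by
  simp [dot, Finset.mul_sum, mul_assoc]

theorem dot_neg_left (x y : Octonion ℝ) : dot (-x) y = -dot x y := by
  simp [dot]

theorem dot_sub_left (x y z : Octonion ℝ) : dot (x - y) z = dot x z - dot y z := by
  rw [sub_eq_add_neg, dot_add_left, dot_neg_left, sub_eq_add_neg]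

theorem dot_zero_left (x : Octonion ℝ) : dot 0 x = 0 := by
  simp [dot]

theorem dot_add_right (x y z : Octonion ℝ) : dot x (y + z) = dot x y + dot x z := by
  rw [dot_comm, dot_add_left, dot_comm y, dot_comm z]

theorem dot_smul_right (r : ℝ) (x y : Octonion ℝ) : dot x (r • y) = r * dot x y := by
  rw [dot_comm, dot_smul_left, dot_comm]

theorem dot_neg_right (x y : Octonion ℝ) : dot x (-y) = -dot x y := by
  rw [dot_comm, dot_neg_left, dot_comm]

theorem dot_sub_right (x y z : Octonion ℝ) : dot x (y - z) = dot x y - dot x z := by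
  rw [dot_comm, dot_sub_left, dot_comm y, dot_comm z]

theorem dot_zero_right (x : Octonion ℝ) : dot x 0 = 0 := by
  rw [dot_comm, dot_zero_left]

theorem dot_self_nonneg (x : Octonion ℝ) : 0 ≤ dot x x :=
  Finset.sum_nonneg fun i _ => mul_self_nonneg (x.coord i)

theorem eq_zero_of_dot_self {x : Octonion ℝ} (h : dot x x = 0) : x = 0 := by
  refine ext_coord fun i => ?_
  have := (Finset.sum_eq_zero_iff_of_nonneg fun i _ => mul_self_nonneg (x.coord i)).1 h i
    (Finset.mem_univ i)
  simpa using this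

theorem dot_one_right (x : Octonion ℝ) : dot x 1 = x.coord 0 := by
  simp [dot, coord_one]

theorem dot_one_one : dot 1 1 = 1 := by
  rw [dot_one_right, coord_one, if_pos rfl]

theorem dot_conj_conj (x y : Octonion ℝ) : dot (conj x) (conj y) = dot x y := by
  refine Finset.sum_congr rfl fun i _ => ?_
  rw [coord_conj, coord_conj]
  split <;> ring

theorem mul_conj_add (x y : Octonion ℝ) : x * conj y + y * conj x = (2 * dot x y) • 1 := by
  apply ext_coords <;>
    simp [coord_mul_0, coord_mul_1, coord_mul_2, coord_mul_3, coord_mul_4, coord_mul_5,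
      coord_mul_6, coord_mul_7, coord_one, coord_conj, dot, Fin.sum_univ_eight] <;> ring

theorem conj_mul_add (x y : Octonion ℝ) : conj x * y + conj y * x = (2 * dot x y) • 1 := by
  have := mul_conj_add (conj x) (conj y)
  rwa [conj_conj, conj_conj, dot_conj_conj] at this

theorem mul_conj_self (x : Octonion ℝ) : x * conj x = dot x x • 1 := by
  apply ext_coords <;>
    simp [coord_mul_0, coord_mul_1, coord_mul_2, coord_mul_3, coord_mul_4, coord_mul_5,
      coord_mul_6, coord_mul_7, coord_one, coord_conj, dot, Fin.sum_univ_eight] <;> ring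

theorem conj_mul_self (x : Octonion ℝ) : conj x * x = dot x x • 1 := by
  have := mul_conj_self (conj x)
  rwa [conj_conj, dot_conj_conj] at this

/-- The trilinear form `Re((x y) z)` is cyclic. -/
theorem dot_conj_mul_cyclic (x y z : Octonion ℝ) :
    dot (conj (x * y)) z = dot (conj (y * z)) x := by
  simp [dot, Fin.sum_univ_eight, coord_conj, coord_mul_0, coord_mul_1, coord_mul_2, coord_mul_3,
    coord_mul_4, coord_mul_5, coord_mul_6, coord_mul_7]
  ring

/-- The norm is multiplicative: the octonions are a composition algebra. -/
theorem dot_mul_self (x y : Octonion ℝ) : dot (x * y) (x * y) = dot x x * dot y y := by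
  simp only [dot, Fin.sum_univ_eight, coord_mul_0, coord_mul_1, coord_mul_2, coord_mul_3,
    coord_mul_4, coord_mul_5, coord_mul_6, coord_mul_7]
  ring

theorem conj_mul_cancel (x y : Octonion ℝ) : conj x * (x * y) = dot x x • y := by
  apply ext_coords <;>
    simp [coord_mul_0, coord_mul_1, coord_mul_2, coord_mul_3, coord_mul_4, coord_mul_5,
      coord_mul_6, coord_mul_7, coord_conj, dot, Fin.sum_univ_eight] <;> ring

theorem mul_conj_cancel (x y : Octonion ℝ) : x * (conj x * y) = dot x x • y := by
  have := conj_mul_cancel (conj x) y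
  rwa [conj_conj, dot_conj_conj] at this

theorem mul_conj_mul_cancel (x y : Octonion ℝ) : y * conj x * x = dot x x • y := by
  have := congrArg conj (conj_mul_cancel x (conj y))
  rwa [conj_mul, conj_mul, conj_smul, conj_conj, conj_conj] at this

theorem mul_mul_conj_cancel (x y : Octonion ℝ) : y * x * conj x = dot x x • y := by
  have := mul_conj_mul_cancel (conj x) y
  rwa [conj_conj, dot_conj_conj] at this

theorem mul_mul_self (a w : Octonion ℝ) :
    a * w * a = (2 * dot a (conj w)) • a - dot a a • conj w := by
  have h := mul_conj_add a (conj w)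
  rw [conj_conj, ← eq_sub_iff_add_eq] at h
  rw [h, sub_mul, mul_conj_mul_cancel, smul_mul_eq, one_mul]

theorem mul_mul_self' (a w : Octonion ℝ) : a * (w * a) = a * w * a := by
  have h := conj_mul_add (conj w) a
  rw [conj_conj, ← eq_sub_iff_add_eq] at h
  rw [h, mul_sub, mul_conj_cancel, mul_smul_eq, mul_one, mul_mul_self, dot_comm]

theorem middle_moufang (a x y : Octonion ℝ) :
    (a * x) * (y * a) = (2 * dot a (conj (x * y))) • a - dot a a • conj (x * y) := by
  apply ext_coords <;>
    simp only [coord_mul_0, coord_mul_1, coord_mul_2, coord_mul_3, coord_mul_4, coord_mul_5,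
      coord_mul_6, coord_mul_7, coord_conj, dot, Fin.sum_univ_eight, sub_eq_add_neg, coord_add,
      coord_neg, coord_smul, smul_eq_mul] <;> simp <;> ring

theorem left_moufang (a x y : Octonion ℝ) : a * (x * (a * y)) = a * x * a * y := by
  apply ext_coords <;>
    simp only [coord_mul_0, coord_mul_1, coord_mul_2, coord_mul_3, coord_mul_4, coord_mul_5,
      coord_mul_6, coord_mul_7] <;> ring

theorem right_moufang (a x y : Octonion ℝ) : x * a * y * a = x * (a * y * a) := by
  have := congrArg conj (left_moufang (conj a) (conj y) (conj x))
  simp only [conj_mul, conj_conj] at this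
  rw [this, mul_mul_self']

end Octonion

open Octonion

/-! ### The Jordan algebra in coordinates -/

theorem exists_h1 (X : J1) :
    ∃ (ξ₁ ξ₂ ξ₃ : ℝ) (x₁ x₂ x₃ : Octonion ℝ), X = h1 ξ₁ ξ₂ ξ₃ x₁ x₂ x₃ := by
  obtain ⟨ξ₁, ξ₂, ξ₃, x₁, x₂, x₃, h⟩ := mem_J1_iff_exists.1 X.2
  exact ⟨ξ₁, ξ₂, ξ₃, x₁, x₂, x₃, Subtype.ext h⟩

theorem h1_add (ξ₁ ξ₂ ξ₃ η₁ η₂ η₃ : ℝ) (x₁ x₂ x₃ y₁ y₂ y₃ : Octonion ℝ) :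
    h1 ξ₁ ξ₂ ξ₃ x₁ x₂ x₃ + h1 η₁ η₂ η₃ y₁ y₂ y₃ =
      h1 (ξ₁ + η₁) (ξ₂ + η₂) (ξ₃ + η₃) (x₁ + y₁) (x₂ + y₂) (x₃ + y₃) := by
  apply Subtype.ext
  funext i j
  fin_cases i <;> fin_cases j <;>
    simp [h1, h1Mat, toComplex_add, conj_add, add_smul]

theorem h1_smul (r ξ₁ ξ₂ ξ₃ : ℝ) (x₁ x₂ x₃ : Octonion ℝ) :
    r • h1 ξ₁ ξ₂ ξ₃ x₁ x₂ x₃ = h1 (r * ξ₁) (r * ξ₂) (r * ξ₃) (r • x₁) (r • x₂) (r • x₃) := by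
  apply Subtype.ext
  funext i j
  fin_cases i <;> fin_cases j <;>
    simp [h1, h1Mat, toComplex_smul, conj_smul, mul_smul, smul_comm r Complex.I]

theorem h1_neg (ξ₁ ξ₂ ξ₃ : ℝ) (x₁ x₂ x₃ : Octonion ℝ) :
    -h1 ξ₁ ξ₂ ξ₃ x₁ x₂ x₃ = h1 (-ξ₁) (-ξ₂) (-ξ₃) (-x₁) (-x₂) (-x₃) := by
  rw [← neg_one_smul ℝ, h1_smul]
  simp only [neg_mul, one_mul, neg_smul, one_smul]

theorem h1_sub (ξ₁ ξ₂ ξ₃ η₁ η₂ η₃ : ℝ) (x₁ x₂ x₃ y₁ y₂ y₃ : Octonion ℝ) :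
    h1 ξ₁ ξ₂ ξ₃ x₁ x₂ x₃ - h1 η₁ η₂ η₃ y₁ y₂ y₃ =
      h1 (ξ₁ - η₁) (ξ₂ - η₂) (ξ₃ - η₃) (x₁ - y₁) (x₂ - y₂) (x₃ - y₃) := by
  simp only [sub_eq_add_neg, h1_neg, h1_add]

theorem h1_inj {ξ₁ ξ₂ ξ₃ η₁ η₂ η₃ : ℝ} {x₁ x₂ x₃ y₁ y₂ y₃ : Octonion ℝ} :
    h1 ξ₁ ξ₂ ξ₃ x₁ x₂ x₃ = h1 η₁ η₂ η₃ y₁ y₂ y₃ ↔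
      ξ₁ = η₁ ∧ ξ₂ = η₂ ∧ ξ₃ = η₃ ∧ x₁ = y₁ ∧ x₂ = y₂ ∧ x₃ = y₃ := by
  refine ⟨fun h => ?_, by rintro ⟨rfl, rfl, rfl, rfl, rfl, rfl⟩; rfl⟩
  have hij : ∀ i j, h1Mat ξ₁ ξ₂ ξ₃ x₁ x₂ x₃ i j = h1Mat η₁ η₂ η₃ y₁ y₂ y₃ i j :=
    fun i j => congrFun (congrFun (congrArg Subtype.val h) i) j
  have hdiag : ∀ {a b : ℝ}, a • (1 : Octonion ℂ) = b • 1 → a = b := fun {a b} h => by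
    simpa [coord_one] using congrArg (fun z => (z.coord 0).re) h
  have hoff : ∀ {a b : Octonion ℝ}, Complex.I • toComplex a = Complex.I • toComplex b → a = b :=
    fun {a b} h => ext_coord fun k => by
      simpa [coord_toComplex] using congrArg (fun z => z.coord k) h
  exact ⟨hdiag (hij 0 0), hdiag (hij 1 1), hdiag (hij 2 2), toComplex_injective (hij 1 2),
    hoff (hij 2 0), hoff (hij 0 1)⟩

theorem h1_zero : h1 0 0 0 0 0 0 = 0 := by
  have := h1_smul 0 0 0 0 0 0 0
  rwa [zero_smul, mul_zero, smul_zero, eq_comm] at this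

theorem conj_sub (x y : Octonion ℝ) : conj (x - y) = conj x - conj y := by
  rw [sub_eq_add_neg, conj_add, conj_neg, sub_eq_add_neg]

/-- The Jordan product in coordinates. -/
theorem jordan_h1 (ξ₁ ξ₂ ξ₃ η₁ η₂ η₃ : ℝ) (x₁ x₂ x₃ y₁ y₂ y₃ : Octonion ℝ) :
    jordan (h1 ξ₁ ξ₂ ξ₃ x₁ x₂ x₃) (h1 η₁ η₂ η₃ y₁ y₂ y₃) =
      h1 (ξ₁ * η₁ - dot x₂ y₂ - dot x₃ y₃) (ξ₂ * η₂ + dot x₁ y₁ - dot x₃ y₃)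
        (ξ₃ * η₃ + dot x₁ y₁ - dot x₂ y₂)
        ((2⁻¹ : ℝ) • ((ξ₂ + ξ₃) • y₁ + (η₂ + η₃) • x₁ - conj (x₂ * y₃) - conj (y₂ * x₃)))
        ((2⁻¹ : ℝ) • ((ξ₃ + ξ₁) • y₂ + (η₃ + η₁) • x₂ + conj (x₃ * y₁) + conj (y₃ * x₁)))
        ((2⁻¹ : ℝ) • ((ξ₁ + ξ₂) • y₃ + (η₁ + η₂) • x₃ + conj (x₁ * y₂) + conj (y₁ * x₂))) := by
  have hm : ∀ x y : Octonion ℝ, toComplex x * toComplex (conj y) +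
      toComplex y * toComplex (conj x) = (2 * dot x y) • 1 := fun x y => by
    rw [← toComplex_mul, ← toComplex_mul, ← toComplex_add, mul_conj_add, toComplex_smul,
      toComplex_one]
  have hm' : ∀ x y : Octonion ℝ, toComplex (conj x) * toComplex y +
      toComplex (conj y) * toComplex x = (2 * dot x y) • 1 := fun x y => by
    rw [← toComplex_mul, ← toComplex_mul, ← toComplex_add, conj_mul_add, toComplex_smul,
      toComplex_one]
  have hI : ∀ x : Octonion ℂ, Complex.I • Complex.I • x = -x := fun x => by
    rw [smul_smul, Complex.I_mul_I, neg_one_smul]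
  have hc : ∀ (r : ℝ) (x : Octonion ℂ), r • Complex.I • x = Complex.I • r • x := fun r x =>
    smul_comm _ _ _
  have h2 : ∀ (x : Octonion ℂ), x = (2⁻¹ : ℝ) • (2 : ℝ) • x := fun x => by
    rw [smul_smul]; norm_num
  apply Subtype.ext
  funext i j
  change (2⁻¹ : ℝ) • ((h1Mat _ _ _ _ _ _ * h1Mat _ _ _ _ _ _) i j +
    (h1Mat _ _ _ _ _ _ * h1Mat _ _ _ _ _ _) i j) = h1Mat _ _ _ _ _ _ i j
  rw [Matrix.mul_apply, Matrix.mul_apply, Fin.sum_univ_three, Fin.sum_univ_three]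
  rw [h2 (h1Mat _ _ _ _ _ _ i j)]
  congr 1
  fin_cases i <;> fin_cases j <;> simp [h1Mat, smul_mul_eq, mul_smul_eq, hI, conj_smul,
    toComplex_smul, toComplex_add, toComplex_neg, conj_add, conj_neg, Octonion.conj_mul, conj_conj,
    toComplex_mul, sub_eq_add_neg, hc]
  · linear_combination (norm := module) -hm x₃ y₃ - hm' x₂ y₂
  · simp only [add_smul, smul_add]; abel
  · simp only [add_smul, smul_add]; abel
  · simp only [add_smul, smul_add]; abel
  · linear_combination (norm := module) hm x₁ y₁ - hm' x₃ y₃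
  · module
  · simp only [add_smul, smul_add]; abel
  · module
  · linear_combination (norm := module) hm' x₁ y₁ - hm x₂ y₂

theorem ip_h1 (ξ₁ ξ₂ ξ₃ η₁ η₂ η₃ : ℝ) (x₁ x₂ x₃ y₁ y₂ y₃ : Octonion ℝ) :
    ip (h1 ξ₁ ξ₂ ξ₃ x₁ x₂ x₃) (h1 η₁ η₂ η₃ y₁ y₂ y₃) =
      ξ₁ * η₁ + ξ₂ * η₂ + ξ₃ * η₃ + 2 * dot x₁ y₁ - 2 * dot x₂ y₂ - 2 * dot x₃ y₃ := by
  rw [ip, jordan_h1, tr_h1]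
  ring

/-- The cross product in coordinates. -/
theorem cross_h1 (ξ₁ ξ₂ ξ₃ η₁ η₂ η₃ : ℝ) (x₁ x₂ x₃ y₁ y₂ y₃ : Octonion ℝ) :
    cross (h1 ξ₁ ξ₂ ξ₃ x₁ x₂ x₃) (h1 η₁ η₂ η₃ y₁ y₂ y₃) =
      h1 (2⁻¹ * (ξ₂ * η₃ + ξ₃ * η₂) - dot x₁ y₁) (2⁻¹ * (ξ₃ * η₁ + ξ₁ * η₃) + dot x₂ y₂)
        (2⁻¹ * (ξ₁ * η₂ + ξ₂ * η₁) + dot x₃ y₃)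
        ((2⁻¹ : ℝ) • (-conj (x₂ * y₃) - conj (y₂ * x₃) - ξ₁ • y₁ - η₁ • x₁))
        ((2⁻¹ : ℝ) • (conj (x₃ * y₁) + conj (y₃ * x₁) - ξ₂ • y₂ - η₂ • x₂))
        ((2⁻¹ : ℝ) • (conj (x₁ * y₂) + conj (y₁ * x₂) - ξ₃ • y₃ - η₃ • x₃)) := by
  rw [cross, jordan_h1, ip_h1, tr_h1, tr_h1, E]
  simp only [h1_smul, h1_add, h1_sub, h1_inj]
  refine ⟨by ring, by ring, by ring, by module, by module, by module⟩

theorem sharp_h1 (ξ₁ ξ₂ ξ₃ : ℝ) (x₁ x₂ x₃ : Octonion ℝ) :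
    cross (h1 ξ₁ ξ₂ ξ₃ x₁ x₂ x₃) (h1 ξ₁ ξ₂ ξ₃ x₁ x₂ x₃) =
      h1 (ξ₂ * ξ₃ - dot x₁ x₁) (ξ₃ * ξ₁ + dot x₂ x₂) (ξ₁ * ξ₂ + dot x₃ x₃)
        (-conj (x₂ * x₃) - ξ₁ • x₁) (conj (x₃ * x₁) - ξ₂ • x₂) (conj (x₁ * x₂) - ξ₃ • x₃) := by
  rw [cross_h1, h1_inj]
  refine ⟨by ring, by ring, by ring, by module, by module, by module⟩

theorem det_h1 (ξ₁ ξ₂ ξ₃ : ℝ) (x₁ x₂ x₃ : Octonion ℝ) :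
    det (h1 ξ₁ ξ₂ ξ₃ x₁ x₂ x₃) =
      ξ₁ * ξ₂ * ξ₃ - ξ₁ * dot x₁ x₁ + ξ₂ * dot x₂ x₂ + ξ₃ * dot x₃ x₃ -
        2 * dot (conj (x₂ * x₃)) x₁ := by
  rw [det, sharp_h1, ip_h1]
  simp only [dot_sub_right, dot_neg_right, dot_smul_right]
  rw [dot_comm x₁ (conj _), dot_comm x₂ (conj _), dot_comm x₃ (conj _)]
  linarith [dot_conj_mul_cyclic x₂ x₃ x₁, dot_conj_mul_cyclic x₁ x₂ x₃]

/-! ### The identities of a cubic norm structure -/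

theorem ip_comm (X Y : J1) : ip X Y = ip Y X := by
  obtain ⟨ξ₁, ξ₂, ξ₃, x₁, x₂, x₃, rfl⟩ := exists_h1 X
  obtain ⟨η₁, η₂, η₃, y₁, y₂, y₃, rfl⟩ := exists_h1 Y
  rw [ip_h1, ip_h1, dot_comm x₁, dot_comm x₂, dot_comm x₃]
  ring

/-- The trace form is associative. -/
theorem ip_jordan (X Y Z : J1) : ip (jordan X Y) Z = ip X (jordan Y Z) := by
  obtain ⟨ξ₁, ξ₂, ξ₃, x₁, x₂, x₃, rfl⟩ := exists_h1 X
  obtain ⟨η₁, η₂, η₃, y₁, y₂, y₃, rfl⟩ := exists_h1 Y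
  obtain ⟨ζ₁, ζ₂, ζ₃, z₁, z₂, z₃, rfl⟩ := exists_h1 Z
  rw [jordan_h1, jordan_h1, ip_h1, ip_h1]
  simp only [dot_sub_right, dot_add_right, dot_smul_right, dot_sub_left, dot_add_left,
    dot_smul_left]
  rw [dot_comm x₁ (conj _), dot_comm x₂ (conj _), dot_comm x₃ (conj _), dot_comm x₁ (conj _),
    dot_comm x₂ (conj _), dot_comm x₃ (conj _)]
  have h1 := dot_conj_mul_cyclic x₂ y₃ z₁
  have h2 := dot_conj_mul_cyclic z₁ x₂ y₃
  have h3 := dot_conj_mul_cyclic y₂ x₃ z₁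
  have h4 := dot_conj_mul_cyclic x₃ z₁ y₂
  have h5 := dot_conj_mul_cyclic x₃ y₁ z₂
  have h6 := dot_conj_mul_cyclic z₂ x₃ y₁
  have h7 := dot_conj_mul_cyclic y₃ x₁ z₂
  have h8 := dot_conj_mul_cyclic x₁ z₂ y₃
  have h9 := dot_conj_mul_cyclic x₁ y₂ z₃
  have h10 := dot_conj_mul_cyclic z₃ x₁ y₂
  have h11 := dot_conj_mul_cyclic y₁ x₂ z₃
  have h12 := dot_conj_mul_cyclic x₂ z₃ y₁
  linarith

theorem conj_mul_conj_mul (a b : Octonion ℝ) : conj (a * conj (b * a)) = dot a a • b := by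
  rw [Octonion.conj_mul b a, mul_conj_cancel, conj_smul,
    conj_conj]

theorem conj_conj_mul_mul (a b : Octonion ℝ) : conj (conj (a * b) * a) = dot a a • b := by
  rw [Octonion.conj_mul a b, mul_conj_mul_cancel, conj_smul, conj_conj]

/-- `X ∘ X^{×2} = det(X) E`, a form of the Cayley–Hamilton identity. -/
theorem jordan_sharp (X : J1) : jordan X (cross X X) = det X • E := by
  obtain ⟨ξ₁, ξ₂, ξ₃, x₁, x₂, x₃, rfl⟩ := exists_h1 X
  have h₂ := dot_conj_mul_cyclic x₂ x₃ x₁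
  have h₃ := dot_conj_mul_cyclic x₁ x₂ x₃
  rw [sharp_h1, jordan_h1, det_h1, E, h1_smul, h1_inj]
  simp only [dot_sub_right, dot_neg_right, dot_smul_right, mul_sub, sub_mul, mul_neg, neg_mul,
    mul_smul_eq, smul_mul_eq, conj_sub, conj_neg, conj_smul, conj_mul_conj_mul,
    conj_conj_mul_mul, dot_comm x₁ (conj _), dot_comm x₂ (conj _), dot_comm x₃ (conj _)]
  refine ⟨by linarith, by linarith, by linarith, ?_, ?_, ?_⟩ <;> module

/-- The adjoint identity `(X^{×2})^{×2} = det(X) X`. -/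
theorem sharp_sharp (X : J1) : cross (cross X X) (cross X X) = det X • X := by
  obtain ⟨ξ₁, ξ₂, ξ₃, x₁, x₂, x₃, rfl⟩ := exists_h1 X
  have h₂ := dot_conj_mul_cyclic x₂ x₃ x₁
  have h₃ := dot_conj_mul_cyclic x₁ x₂ x₃
  have hM : ∀ a b c : Octonion ℝ, conj (conj (c * a) * conj (a * b)) =
      (2 * dot a (conj (b * c))) • a - dot a a • conj (b * c) := fun a b c => by
    rw [Octonion.conj_mul, conj_conj, conj_conj, middle_moufang]
  rw [sharp_h1, sharp_h1, det_h1, h1_smul, h1_inj]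
  simp only [dot_sub_right, dot_neg_right, dot_smul_right, dot_sub_left, dot_neg_left,
    dot_smul_left, mul_sub, sub_mul, mul_neg, neg_mul, dot_conj_conj, dot_mul_self,
    mul_smul_eq, smul_mul_eq, conj_sub, conj_neg, conj_smul, conj_mul_conj_mul, hM,
    conj_conj_mul_mul, dot_comm x₁ (conj _), dot_comm x₂ (conj _), dot_comm x₃ (conj _)]
  rw [← h₂, h₃]
  refine ⟨by ring, by ring, by ring, ?_, ?_, ?_⟩ <;> module

theorem tr_add (X Y : J1) : tr (X + Y) = tr X + tr Y := by
  simp [tr, Finset.sum_add_distrib]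

theorem tr_smul (r : ℝ) (X : J1) : tr (r • X) = r * tr X := by
  simp [tr, Finset.mul_sum]

theorem tr_sub (X Y : J1) : tr (X - Y) = tr X - tr Y := by
  rw [sub_eq_add_neg, tr_add, ← neg_one_smul ℝ Y, tr_smul, neg_one_mul, sub_eq_add_neg]

theorem tr_E : tr E = 3 := by
  rw [E, tr_h1]; norm_num

theorem jordan_comm (X Y : J1) : jordan X Y = jordan Y X :=
  Subtype.ext (congrArg ((2⁻¹ : ℝ) • ·) (add_comm _ _))

theorem jordan_add_left (X Y Z : J1) : jordan (X + Y) Z = jordan X Z + jordan Y Z := by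
  apply Subtype.ext
  change (2⁻¹ : ℝ) • ((X.1 + Y.1) * Z.1 + Z.1 * (X.1 + Y.1)) =
    (2⁻¹ : ℝ) • (X.1 * Z.1 + Z.1 * X.1) + (2⁻¹ : ℝ) • (Y.1 * Z.1 + Z.1 * Y.1)
  rw [Matrix.add_mul, Matrix.mul_add]
  module

theorem jordan_smul_left (r : ℝ) (X Y : J1) : jordan (r • X) Y = r • jordan X Y := by
  obtain ⟨ξ₁, ξ₂, ξ₃, x₁, x₂, x₃, rfl⟩ := exists_h1 X
  obtain ⟨η₁, η₂, η₃, y₁, y₂, y₃, rfl⟩ := exists_h1 Y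
  simp only [h1_smul, jordan_h1, h1_inj, dot_smul_left, smul_mul_eq, mul_smul_eq, conj_smul]
  refine ⟨by ring, by ring, by ring, by module, by module, by module⟩

theorem jordan_add_right (X Y Z : J1) : jordan X (Y + Z) = jordan X Y + jordan X Z := by
  rw [jordan_comm, jordan_add_left, jordan_comm Y, jordan_comm Z]

theorem jordan_smul_right (r : ℝ) (X Y : J1) : jordan X (r • Y) = r • jordan X Y := by
  rw [jordan_comm, jordan_smul_left, jordan_comm]

theorem jordan_sub_left (X Y Z : J1) : jordan (X - Y) Z = jordan X Z - jordan Y Z := by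
  have h : X - Y = X + (-1 : ℝ) • Y := by module
  rw [h, jordan_add_left, jordan_smul_left]
  module

theorem jordan_sub_right (X Y Z : J1) : jordan X (Y - Z) = jordan X Y - jordan X Z := by
  rw [jordan_comm, jordan_sub_left, jordan_comm Y, jordan_comm Z]

theorem jordan_E (X : J1) : jordan E X = X := by
  obtain ⟨ξ₁, ξ₂, ξ₃, x₁, x₂, x₃, rfl⟩ := exists_h1 X
  rw [E, jordan_h1, h1_inj]
  simp only [dot_zero_left, zero_mul, mul_zero, conj_zero, smul_zero]
  refine ⟨by ring, by ring, by ring, by module, by module, by module⟩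

theorem ip_add_left (X Y Z : J1) : ip (X + Y) Z = ip X Z + ip Y Z := by
  rw [ip, jordan_add_left, tr_add, ip, ip]

theorem ip_smul_left (r : ℝ) (X Y : J1) : ip (r • X) Y = r * ip X Y := by
  rw [ip, jordan_smul_left, tr_smul, ip]

theorem ip_sub_left (X Y Z : J1) : ip (X - Y) Z = ip X Z - ip Y Z := by
  rw [ip, jordan_sub_left, tr_sub, ip, ip]

theorem ip_add_right (X Y Z : J1) : ip X (Y + Z) = ip X Y + ip X Z := by
  rw [ip, jordan_add_right, tr_add, ip, ip]

theorem ip_smul_right (r : ℝ) (X Y : J1) : ip X (r • Y) = r * ip X Y := by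
  rw [ip, jordan_smul_right, tr_smul, ip]

theorem ip_sub_right (X Y Z : J1) : ip X (Y - Z) = ip X Y - ip X Z := by
  rw [ip, jordan_sub_right, tr_sub, ip, ip]

theorem ip_E (X : J1) : ip X E = tr X := by
  rw [ip, jordan_comm, jordan_E]

theorem cross_eq (X Y : J1) : cross X Y = jordan X Y - (2⁻¹ * tr X) • Y - (2⁻¹ * tr Y) • X +
    (2⁻¹ * (tr X * tr Y - ip X Y)) • E := by
  rw [cross]; module

theorem cross_comm (X Y : J1) : cross X Y = cross Y X := by
  rw [cross_eq, cross_eq, jordan_comm, ip_comm]; module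

theorem cross_add_left (X Y Z : J1) : cross (X + Y) Z = cross X Z + cross Y Z := by
  simp only [cross_eq, jordan_add_left, tr_add, ip_add_left]; module

theorem cross_smul_left (r : ℝ) (X Y : J1) : cross (r • X) Y = r • cross X Y := by
  simp only [cross_eq, jordan_smul_left, tr_smul, ip_smul_left]; module

theorem cross_sub_left (X Y Z : J1) : cross (X - Y) Z = cross X Z - cross Y Z := by
  simp only [cross_eq, jordan_sub_left, tr_sub, ip_sub_left]; module

theorem cross_add_right (X Y Z : J1) : cross X (Y + Z) = cross X Y + cross X Z := by
  simp only [cross_eq, jordan_add_right, tr_add, ip_add_right]; module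

theorem cross_smul_right (r : ℝ) (X Y : J1) : cross X (r • Y) = r • cross X Y := by
  simp only [cross_eq, jordan_smul_right, tr_smul, ip_smul_right]; module

theorem cross_sub_right (X Y Z : J1) : cross X (Y - Z) = cross X Y - cross X Z := by
  simp only [cross_eq, jordan_sub_right, tr_sub, ip_sub_right]; module

theorem cross_E_left (X : J1) : cross E X = (2⁻¹ : ℝ) • (tr X • E - X) := by
  rw [cross_eq, jordan_E, ip_comm, ip_E, tr_E]; module

theorem tr_cross (X Y : J1) : tr (cross X Y) = 2⁻¹ * (tr X * tr Y - ip X Y) := by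
  rw [cross_eq, tr_add, tr_sub, tr_sub, tr_smul, tr_smul, tr_smul, tr_E, ← ip]; ring

/-- The trilinear form `(X × Y|Z)` is symmetric. -/
theorem ip_cross (X Y Z : J1) : ip (cross X Y) Z = ip X (cross Y Z) := by
  simp only [cross_eq, ip_add_left, ip_sub_left, ip_smul_left, ip_add_right, ip_sub_right,
    ip_smul_right, ip_jordan, ip_comm E, ip_E]
  ring

/-- The identity `X ∘ X^{×2} = det(X) E` in terms of the cross product. -/
theorem cross_sharp (X : J1) : cross X (cross X X) =
    (2⁻¹ * (tr X * tr (cross X X) - det X)) • E - (2⁻¹ * tr X) • cross X X -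
      (2⁻¹ * tr (cross X X)) • X := by
  have h : ip X (cross X X) = 3 * det X := by rw [det]; ring
  rw [cross_eq X (cross X X), jordan_sharp, h]
  module

section RankOne

variable {P : J1} (hP : cross P P = 0)

include hP

theorem sharp_add_of_sharp_eq_zero (X : J1) :
    cross (X + P) (X + P) = cross X X + (2 : ℝ) • cross P X := by
  rw [cross_add_left, cross_add_right, cross_add_right, hP, cross_comm X P]; module

theorem sharp_sub_of_sharp_eq_zero (X : J1) :
    cross (X - P) (X - P) = cross X X - (2 : ℝ) • cross P X := by
  rw [cross_sub_left, cross_sub_right, cross_sub_right, hP, cross_comm X P]; module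

theorem ip_cross_of_sharp_eq_zero (X : J1) : ip P (cross P X) = 0 := by
  rw [← ip_cross, hP, ← zero_smul ℝ (0 : J1), ip_smul_left, zero_mul]

theorem det_add_of_sharp_eq_zero (X : J1) : det (X + P) = det X + ip (cross X X) P := by
  rw [det, sharp_add_of_sharp_eq_zero hP, det]
  simp only [ip_add_left, ip_add_right, ip_smul_right]
  rw [ip_cross_of_sharp_eq_zero hP, ip_comm X (cross P X), ip_cross, ip_comm (cross X X)]
  ring

theorem det_sub_of_sharp_eq_zero (X : J1) : det (X - P) = det X - ip (cross X X) P := by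
  rw [det, sharp_sub_of_sharp_eq_zero hP, det]
  simp only [ip_sub_left, ip_sub_right, ip_smul_right]
  rw [ip_cross_of_sharp_eq_zero hP, ip_comm X (cross P X), ip_cross, ip_comm (cross X X)]
  ring

/-- The part of `cross_sharp` at `X + P` that is quadratic in `P`. -/
theorem cross_cross_of_sharp_eq_zero (X : J1) : (2 : ℝ) • cross P (cross P X) =
    (tr P * tr (cross P X)) • E - tr P • cross P X - tr (cross P X) • P := by
  have h₁ := cross_sharp (X + P)
  have h₂ := cross_sharp (X - P)
  have h₃ := cross_sharp X
  rw [sharp_add_of_sharp_eq_zero hP, det_add_of_sharp_eq_zero hP] at h₁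
  rw [sharp_sub_of_sharp_eq_zero hP, det_sub_of_sharp_eq_zero hP] at h₂
  simp only [cross_add_left, cross_add_right, cross_smul_right, tr_add, tr_smul] at h₁
  simp only [cross_sub_left, cross_sub_right, cross_smul_right, tr_sub, tr_smul] at h₂
  linear_combination (norm := module) (2⁻¹ : ℝ) • h₁ + (2⁻¹ : ℝ) • h₂ - h₃

/-- The part of `cross_sharp` at `X + P` that is linear in `P`. -/
theorem cross_cross_self_of_sharp_eq_zero (X : J1) :
    (2 : ℝ) • cross X (cross P X) + cross P (cross X X) =
      (2⁻¹ * (tr P * tr (cross X X) + 2 * tr (cross P X) * tr X - ip (cross X X) P)) • E -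
        (2⁻¹ : ℝ) • (tr P • cross X X + (2 * tr X) • cross P X) -
        (2⁻¹ : ℝ) • (tr (cross X X) • P + (2 * tr (cross P X)) • X) := by
  have h₁ := cross_sharp (X + P)
  have h₂ := cross_sharp (X - P)
  rw [sharp_add_of_sharp_eq_zero hP, det_add_of_sharp_eq_zero hP] at h₁
  rw [sharp_sub_of_sharp_eq_zero hP, det_sub_of_sharp_eq_zero hP] at h₂
  simp only [cross_add_left, cross_add_right, cross_smul_right, tr_add, tr_smul] at h₁
  simp only [cross_sub_left, cross_sub_right, cross_smul_right, tr_sub, tr_smul] at h₂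
  linear_combination (norm := module) (2⁻¹ : ℝ) • h₁ - (2⁻¹ : ℝ) • h₂

/-- The part of `sharp_sharp` at `X + P` that is quadratic in `P`. -/
theorem sharp_cross_of_sharp_eq_zero (X : J1) :
    (4 : ℝ) • cross (cross P X) (cross P X) = ip (cross X X) P • P := by
  have h₁ := sharp_sharp (X + P)
  have h₂ := sharp_sharp (X - P)
  have h₃ := sharp_sharp X
  rw [sharp_add_of_sharp_eq_zero hP, det_add_of_sharp_eq_zero hP] at h₁
  rw [sharp_sub_of_sharp_eq_zero hP, det_sub_of_sharp_eq_zero hP] at h₂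
  simp only [cross_add_left, cross_add_right, cross_smul_right, cross_smul_left] at h₁
  simp only [cross_sub_left, cross_sub_right, cross_smul_right, cross_smul_left] at h₂
  linear_combination (norm := module) (2⁻¹ : ℝ) • h₁ + (2⁻¹ : ℝ) • h₂ - h₃

theorem ip_self_of_sharp_eq_zero : ip P P = tr P ^ 2 := by
  have h := tr_cross P P
  rw [hP, ← zero_smul ℝ (0 : J1), tr_smul] at h
  linarith

theorem jordan_self_of_sharp_eq_zero : jordan P P = tr P • P := by
  have h := cross_eq P P
  rw [hP, ip_self_of_sharp_eq_zero hP] at h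
  linear_combination (norm := module) -h

theorem jordan_jordan_of_sharp_eq_zero (X : J1) :
    jordan P (jordan P X) = (2⁻¹ * tr P) • jordan P X + (2⁻¹ * ip P X) • P := by
  have h := cross_cross_of_sharp_eq_zero hP X
  have hpp := jordan_self_of_sharp_eq_zero hP
  rw [tr_cross, cross_eq P (cross P X), tr_cross, ip_cross_of_sharp_eq_zero hP,
    cross_eq P X] at h
  simp only [jordan_add_right, jordan_sub_right, jordan_smul_right, hpp, jordan_comm P E,
    jordan_E] at h
  linear_combination (norm := module) (2⁻¹ : ℝ) • h

end RankOne

/-! ### Peirce reflections -/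

/-- A linear map that fixes the identity and preserves the trace and the adjoint `X ↦ X^{×2}`
preserves the Jordan product. -/
theorem map_jordan_of_map_sharp (f : J1 →ₗ[ℝ] J1) (hE : f E = E) (htr : ∀ X, tr (f X) = tr X)
    (hs : ∀ X, cross (f X) (f X) = f (cross X X)) (X Y : J1) :
    f (jordan X Y) = jordan (f X) (f Y) := by
  have hc : cross (f X) (f Y) = f (cross X Y) := by
    have h := hs (X + Y)
    have hX := hs X
    have hY := hs Y
    simp only [map_add, cross_add_left, cross_add_right, cross_comm (f Y) (f X),
      cross_comm Y X] at h
    linear_combination (norm := module) (2⁻¹ : ℝ) • (h - hX - hY)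
  have hip : ip (f X) (f Y) = ip X Y := by
    have h := tr_cross (f X) (f Y)
    rw [hc, htr, htr, htr, tr_cross] at h
    linarith
  rw [cross_eq, cross_eq, htr, htr, hip] at hc
  simp only [map_add, map_sub, map_smul, hE] at hc
  linear_combination (norm := module) -hc

/-- The Peirce reflection `U_{E - 2P}` of a primitive idempotent `P`, as a linear map: it is `1` on
the Peirce spaces `J_0(P)` and `J_1(P)` and `-1` on `J_{1/2}(P)`. -/
noncomputable def reflectionMap (P : J1) : J1 →ₗ[ℝ] J1 where
  toFun X := X - (4 : ℝ) • jordan P X + (4 * ip P X) • P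
  map_add' X Y := by rw [jordan_add_right, ip_add_right]; module
  map_smul' r X := by rw [jordan_smul_right, ip_smul_right, RingHom.id_apply]; module

theorem reflectionMap_apply (P X : J1) :
    reflectionMap P X = X - (4 : ℝ) • jordan P X + (4 * ip P X) • P := rfl

theorem reflectionMap_eq {P : J1} (ht : tr P = 1) (X : J1) : reflectionMap P X =
    (4 * tr (cross P X)) • E - X - (4 : ℝ) • cross P X + (4 * ip P X - 2 * tr X) • P := by
  rw [reflectionMap_apply, tr_cross, cross_eq, ht]; module

section

variable {P : J1} (hP : cross P P = 0) (ht : tr P = 1)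

include hP ht

theorem reflectionMap_reflectionMap (X : J1) : reflectionMap P (reflectionMap P X) = X := by
  have h := jordan_jordan_of_sharp_eq_zero hP X
  have hpp := jordan_self_of_sharp_eq_zero hP
  simp only [reflectionMap_apply, jordan_add_right, jordan_sub_right, jordan_smul_right, h,
    hpp, ip_add_right, ip_sub_right, ip_smul_right, ← ip_jordan, ip_self_of_sharp_eq_zero hP,
    ht, one_smul]
  module

theorem reflectionMap_jordan (X Y : J1) :
    reflectionMap P (jordan X Y) = jordan (reflectionMap P X) (reflectionMap P Y) := by
  refine map_jordan_of_map_sharp _ ?_ (fun X => ?_) (fun X => ?_) X Y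
  · rw [reflectionMap_apply, jordan_comm, jordan_E, ip_E, ht]; module
  · rw [reflectionMap_apply, tr_add, tr_sub, tr_smul, tr_smul, ht, ← ip]; ring
  · rw [reflectionMap_eq ht, reflectionMap_eq ht]
    have hA := cross_cross_of_sharp_eq_zero hP X
    have hB := cross_cross_self_of_sharp_eq_zero hP X
    have hC := sharp_cross_of_sharp_eq_zero hP X
    rw [tr_cross P X, ht] at hA hB
    rw [tr_cross P X, tr_cross P (cross X X), ht, ip_comm P (cross X X)]
    simp only [cross_add_left, cross_sub_left, cross_smul_left, cross_add_right, cross_sub_right,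
      cross_smul_right, cross_comm _ E, cross_E_left, hP, cross_comm X P,
      cross_comm (cross P X) P, cross_comm (cross P X) X, tr_E, tr_cross P X, ht]
    rw [tr_cross X X] at *
    linear_combination (norm := module) (4 : ℝ) • hB + (4 : ℝ) • hC -
      (4 * (4 * ip P X - 2 * tr X)) • hA

end

/-- The Peirce reflection of a primitive idempotent, as an element of the linear group. -/
noncomputable def reflection (P : J1) (hP : cross P P = 0) (ht : tr P = 1) : J1 ≃ₗ[ℝ] J1 :=
  LinearEquiv.ofInvolutive (reflectionMap P) (reflectionMap_reflectionMap hP ht)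

theorem reflection_apply {P : J1} (hP : cross P P = 0) (ht : tr P = 1) (X : J1) :
    reflection P hP ht X = X - (4 : ℝ) • jordan P X + (4 * ip P X) • P := rfl

theorem reflection_mem_F4 {P : J1} (hP : cross P P = 0) (ht : tr P = 1) :
    reflection P hP ht ∈ F4 :=
  reflectionMap_jordan hP ht

/-- For elements `X = x x^*` and `Y = y y^*` of rank one and of the same trace, the reflection of
the idempotent `M` proportional to `(x + y)(x + y)^* = X + Y + (2/c) X ∘ Y`, where
`c = ⟨x, y⟩` is a square root of `(X|Y)`, exchanges `X` and `Y`. -/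
theorem exists_mem_F4_of_ip_pos {X Y : J1} (hX : cross X X = 0) (hY : cross Y Y = 0)
    (htr : tr X = tr Y) (ht : 0 ≤ tr X) (h : 0 < ip X Y) : ∃ g ∈ F4, g X = Y := by
  obtain ⟨c, hc, hcc⟩ : ∃ c : ℝ, 0 < c ∧ ip X Y = c ^ 2 :=
    ⟨√(ip X Y), Real.sqrt_pos.2 h, (Real.sq_sqrt h.le).symm⟩
  obtain ⟨t, htX⟩ : ∃ t, tr X = t := ⟨_, rfl⟩
  have htY : tr Y = t := htr ▸ htX
  rw [htX] at ht
  -- The idempotent `M` is `k N`, where `N = c (X + Y) + 2 X ∘ Y` has no denominators.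
  set k : ℝ := (2 * c * (t + c))⁻¹
  have hk : k * (2 * c * (t + c)) = 1 := inv_mul_cancel₀ (by positivity)
  have hXX := jordan_self_of_sharp_eq_zero hX
  have hXZ := jordan_jordan_of_sharp_eq_zero hX Y
  have hiXX := ip_self_of_sharp_eq_zero hX
  rw [htX] at hXX hXZ hiXX
  rw [hcc] at hXZ
  set N : J1 := c • (X + Y) + (2 : ℝ) • jordan X Y with hN
  have hNt : tr (k • N) = 1 := by
    rw [tr_smul, hN, tr_add, tr_smul, tr_add, tr_smul, ← ip, hcc, htX, htY]
    linear_combination hk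
  have hNs : cross (k • N) (k • N) = 0 := by
    have hA := cross_cross_of_sharp_eq_zero hX Y
    have hB := cross_cross_of_sharp_eq_zero hY X
    have hC := sharp_cross_of_sharp_eq_zero hX Y
    have h0 : ip 0 X = 0 := by rw [← zero_smul ℝ (0 : J1), ip_smul_left, zero_mul]
    rw [cross_comm Y X] at hB
    rw [hY, h0] at hC
    rw [tr_cross, htX, htY, hcc] at hA hB
    have hZ : jordan X Y = cross X Y + (2⁻¹ * t) • Y + (2⁻¹ * t) • X -
        (2⁻¹ * (t * t - c ^ 2)) • E := by
      rw [cross_eq, htX, htY, hcc]; module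
    rw [cross_smul_left, cross_smul_right, hN, hZ]
    simp only [cross_add_left, cross_sub_left, cross_smul_left, cross_add_right, cross_sub_right,
      cross_smul_right, cross_comm _ E, cross_E_left, hX, hY, cross_comm Y X,
      cross_comm (cross X Y) X, cross_comm (cross X Y) Y, tr_E, tr_cross X Y, htX, htY, hcc]
    linear_combination (norm := module) (k * k) • (hC + (2 * c + 2 * t) • hA +
      (2 * c + 2 * t) • hB)
  refine ⟨reflection (k • N) hNs hNt, reflection_mem_F4 _ _, ?_⟩
  have hNX : jordan N X = (c * (t + c)) • X + (t + c) • jordan X Y := by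
    rw [hN, jordan_add_left, jordan_smul_left, jordan_add_left, jordan_smul_left, hXX,
      jordan_comm (jordan X Y), hXZ, jordan_comm Y]
    module
  have hiNX : ip N X = c * (t + c) ^ 2 := by
    rw [hN, ip_add_left, ip_smul_left, ip_add_left, ip_smul_left, hiXX, ip_comm (jordan X Y),
      ← ip_jordan, hXX, ip_smul_left, ip_comm Y, hcc]
    ring
  rw [reflection_apply, jordan_smul_left, hNX, ip_smul_left, hiNX, hN]
  linear_combination (norm := module)
    hk • ((2 * (t + c) * k) • (c • (X + Y) + (2 : ℝ) • jordan X Y) + Y - X)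

/-! ### Invariants of the automorphism group -/

/-- The linear map with the real coordinates of `h¹(ξ; x)` as arguments. -/
noncomputable def ofCoords : (Fin 3 ⊕ Fin 3 × Fin 8 → ℝ) →ₗ[ℝ] J1 where
  toFun v := h1 (v (.inl 0)) (v (.inl 1)) (v (.inl 2)) ⟨fun k => v (.inr (0, k))⟩
    ⟨fun k => v (.inr (1, k))⟩ ⟨fun k => v (.inr (2, k))⟩
  map_add' v w := by rw [h1_add]; rfl
  map_smul' r v := by rw [RingHom.id_apply, h1_smul]; rfl

theorem ofCoords_apply (v : Fin 3 ⊕ Fin 3 × Fin 8 → ℝ) :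
    ofCoords v = h1 (v (.inl 0)) (v (.inl 1)) (v (.inl 2)) ⟨fun k => v (.inr (0, k))⟩
      ⟨fun k => v (.inr (1, k))⟩ ⟨fun k => v (.inr (2, k))⟩ := rfl

theorem ofCoords_elim (ξ₁ ξ₂ ξ₃ : ℝ) (x₁ x₂ x₃ : Octonion ℝ) :
    ofCoords (Sum.elim ![ξ₁, ξ₂, ξ₃] fun p => (![x₁, x₂, x₃] p.1).coord p.2) =
      h1 ξ₁ ξ₂ ξ₃ x₁ x₂ x₃ := rfl

theorem ofCoords_bijective : Function.Bijective ofCoords := by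
  refine ⟨fun v w h => ?_, fun X => ?_⟩
  · rw [ofCoords_apply, ofCoords_apply, h1_inj] at h
    obtain ⟨h1, h2, h3, h4, h5, h6⟩ := h
    simp only [Octonion.mk.injEq, funext_iff] at h4 h5 h6
    ext (i | ⟨i, k⟩) <;> fin_cases i
    exacts [h1, h2, h3, h4 k, h5 k, h6 k]
  · obtain ⟨ξ₁, ξ₂, ξ₃, x₁, x₂, x₃, rfl⟩ := exists_h1 X
    exact ⟨_, ofCoords_elim _ _ _ _ _ _⟩

/-- The real coordinates on `𝒥¹`. -/
noncomputable def coordsEquiv : J1 ≃ₗ[ℝ] (Fin 3 ⊕ Fin 3 × Fin 8 → ℝ) :=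
  (LinearEquiv.ofBijective ofCoords ofCoords_bijective).symm

theorem coordsEquiv_h1 (ξ₁ ξ₂ ξ₃ : ℝ) (x₁ x₂ x₃ : Octonion ℝ) :
    coordsEquiv (h1 ξ₁ ξ₂ ξ₃ x₁ x₂ x₃) =
      Sum.elim ![ξ₁, ξ₂, ξ₃] fun p => (![x₁, x₂, x₃] p.1).coord p.2 := by
  rw [← ofCoords_elim]
  exact (LinearEquiv.ofBijective ofCoords ofCoords_bijective).symm_apply_apply _

/-- The Jordan multiplication by `X` as a linear map. -/
noncomputable def jordanLeft (X : J1) : J1 →ₗ[ℝ] J1 where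
  toFun := jordan X
  map_add' := jordan_add_right X
  map_smul' r := jordan_smul_right r X

/-- The trace form is intrinsic: `tr(X)` is proportional to the trace of the multiplication by
`X` on the `27`-dimensional space `𝒥¹`. -/
theorem trace_jordanLeft (X : J1) : LinearMap.trace ℝ J1 (jordanLeft X) = 9 * tr X := by
  obtain ⟨ξ₁, ξ₂, ξ₃, x₁, x₂, x₃, rfl⟩ := exists_h1 X
  rw [LinearMap.trace_eq_matrix_trace ℝ (Module.Basis.ofEquivFun coordsEquiv), Matrix.trace]
  have hz : (⟨fun _ => 0⟩ : Octonion ℝ) = 0 := rfl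
  simp only [Fintype.sum_sum_type, Fintype.sum_prod_type, Fin.sum_univ_three, Matrix.diag_apply,
    LinearMap.toMatrix_apply, Module.Basis.ofEquivFun_repr_apply, Module.Basis.coe_ofEquivFun]
  have h : ∀ i, jordanLeft (h1 ξ₁ ξ₂ ξ₃ x₁ x₂ x₃) (coordsEquiv.symm (Pi.single i 1)) =
      jordan (h1 ξ₁ ξ₂ ξ₃ x₁ x₂ x₃) (ofCoords (Pi.single i 1)) := fun i => rfl
  simp only [h, ofCoords_apply, jordan_h1, coordsEquiv_h1, tr_h1]
  simp [Pi.single_apply, hz, dot_zero_right, conj_zero]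
  ring

section

variable {g : J1 ≃ₗ[ℝ] J1} (hg : g ∈ F4)

include hg

theorem map_jordan (X Y : J1) : g (jordan X Y) = jordan (g X) (g Y) := hg X Y

theorem map_E : g E = E := by
  have h := hg E (g.symm E)
  rwa [jordan_E, g.apply_symm_apply, jordan_comm, jordan_E, eq_comm] at h

theorem tr_map (X : J1) : tr (g X) = tr X := by
  have h : jordanLeft (g X) = g.conj (jordanLeft X) := by
    ext1 Y
    rw [LinearEquiv.conj_apply_apply]
    change jordan (g X) Y = g (jordan X (g.symm Y))
    rw [map_jordan hg, g.apply_symm_apply]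
  have h2 := trace_jordanLeft (g X)
  rw [h, LinearMap.trace_conj', trace_jordanLeft] at h2
  linarith

theorem ip_map (X Y : J1) : ip (g X) (g Y) = ip X Y := by
  rw [ip, ← map_jordan hg, tr_map hg, ip]

theorem cross_map (X Y : J1) : cross (g X) (g Y) = g (cross X Y) := by
  simp only [cross_eq, map_add, map_sub, map_smul, map_jordan hg, map_E hg, tr_map hg, ip_map hg]

theorem det_map (X : J1) : det (g X) = det X := by
  rw [det, cross_map hg, ip_map hg, det]

end

/-! ### The hyperbolic planes and the null cones of rank one -/

theorem mem_Orb_of_map_eq {g : J1 ≃ₗ[ℝ] J1} (hg : g ∈ F4) {X Y : J1} (h : g X = Y) :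
    X ∈ Orb Y := by
  refine ⟨g⁻¹, F4.inv_mem hg, ?_⟩
  rw [← h]
  exact (g.symm_apply_apply X).symm

theorem Orb_eq_of_map_eq {g : J1 ≃ₗ[ℝ] J1} (hg : g ∈ F4) {X Y : J1} (h : g X = Y) :
    Orb X = Orb Y := by
  have key : ∀ {g : J1 ≃ₗ[ℝ] J1} (_ : g ∈ F4) {X Y : J1}, g X = Y → Orb Y ⊆ Orb X := by
    rintro g hg X _ rfl _ ⟨k, hk, rfl⟩
    exact ⟨k * g, F4.mul_mem hk hg, rfl⟩
  obtain ⟨k, hk, h'⟩ := mem_Orb_of_map_eq hg h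
  exact (key hk h'.symm).antisymm (key hg h)

theorem sharp_h1_eq_zero_iff {ξ₁ ξ₂ ξ₃ : ℝ} {x₁ x₂ x₃ : Octonion ℝ} :
    cross (h1 ξ₁ ξ₂ ξ₃ x₁ x₂ x₃) (h1 ξ₁ ξ₂ ξ₃ x₁ x₂ x₃) = 0 ↔
      ξ₂ * ξ₃ = dot x₁ x₁ ∧ ξ₃ * ξ₁ = -dot x₂ x₂ ∧ ξ₁ * ξ₂ = -dot x₃ x₃ ∧
        -conj (x₂ * x₃) = ξ₁ • x₁ ∧ conj (x₃ * x₁) = ξ₂ • x₂ ∧ conj (x₁ * x₂) = ξ₃ • x₃ := by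
  rw [sharp_h1, ← h1_zero, h1_inj]
  simp only [sub_eq_zero, add_eq_zero_iff_eq_neg]

theorem sharp_E₁ : cross E₁ E₁ = 0 := by
  rw [E₁, sharp_h1_eq_zero_iff]; simp [dot_zero_left, conj_zero]

theorem sharp_E₂ : cross E₂ E₂ = 0 := by
  rw [E₂, sharp_h1_eq_zero_iff]; simp [dot_zero_left, conj_zero]

theorem sharp_E₃ : cross E₃ E₃ = 0 := by
  rw [E₃, sharp_h1_eq_zero_iff]; simp [dot_zero_left, conj_zero]

theorem tr_E₁ : tr E₁ = 1 := by rw [E₁, tr_h1]; norm_num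

theorem tr_E₂ : tr E₂ = 1 := by rw [E₂, tr_h1]; norm_num

theorem tr_E₃ : tr E₃ = 1 := by rw [E₃, tr_h1]; norm_num

theorem ip_h1_E₁ (ξ₁ ξ₂ ξ₃ : ℝ) (x₁ x₂ x₃ : Octonion ℝ) :
    ip (h1 ξ₁ ξ₂ ξ₃ x₁ x₂ x₃) E₁ = ξ₁ := by
  rw [E₁, ip_h1]; simp [dot_zero_right]

theorem ip_h1_E₂ (ξ₁ ξ₂ ξ₃ : ℝ) (x₁ x₂ x₃ : Octonion ℝ) :
    ip (h1 ξ₁ ξ₂ ξ₃ x₁ x₂ x₃) E₂ = ξ₂ := by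
  rw [E₂, ip_h1]; simp [dot_zero_right]

theorem ip_h1_E₃ (ξ₁ ξ₂ ξ₃ : ℝ) (x₁ x₂ x₃ : Octonion ℝ) :
    ip (h1 ξ₁ ξ₂ ξ₃ x₁ x₂ x₃) E₃ = ξ₃ := by
  rw [E₃, ip_h1]; simp [dot_zero_right]

/-- A primitive idempotent cannot have its first diagonal entry strictly between `0` and `1`. -/
theorem one_le_ip_E₁_of_pos {X : J1} (hX : cross X X = 0) (ht : tr X = 1) (h : 0 < ip X E₁) :
    1 ≤ ip X E₁ := by
  obtain ⟨ξ₁, ξ₂, ξ₃, x₁, x₂, x₃, rfl⟩ := exists_h1 X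
  rw [ip_h1_E₁] at h ⊢
  obtain ⟨-, h₂, h₃, -⟩ := sharp_h1_eq_zero_iff.1 hX
  rw [tr_h1] at ht
  nlinarith [dot_self_nonneg x₂, dot_self_nonneg x₃]

theorem exists_map_eq_E₁ {X : J1} (hX : X ∈ H) : ∃ g ∈ F4, g X = E₁ :=
  exists_mem_F4_of_ip_pos hX.1 sharp_E₁ (hX.2.1.trans tr_E₁.symm) (by rw [hX.2.1]; norm_num)
    (by linarith [hX.2.2])

theorem exists_map_E₂_eq_E₃ : ∃ g ∈ F4, g E₂ = E₃ := by
  have hX : cross (h1 0 2⁻¹ 2⁻¹ ((2⁻¹ : ℝ) • 1) 0 0) (h1 0 2⁻¹ 2⁻¹ ((2⁻¹ : ℝ) • 1) 0 0) = 0 := by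
    rw [sharp_h1_eq_zero_iff]
    simp [dot_zero_left, conj_zero, dot_smul_left, dot_smul_right, dot_one_one]
  have ht : tr (h1 0 2⁻¹ 2⁻¹ ((2⁻¹ : ℝ) • 1) 0 0) = 1 := by rw [tr_h1]; norm_num
  obtain ⟨g, hg, h⟩ := exists_mem_F4_of_ip_pos sharp_E₂ hX (tr_E₂.trans ht.symm)
    (by rw [tr_E₂]; norm_num) (by rw [ip_comm, ip_h1_E₂]; norm_num)
  obtain ⟨g', hg', h'⟩ := exists_mem_F4_of_ip_pos hX sharp_E₃ (ht.trans tr_E₃.symm)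
    (by rw [ht]; norm_num) (by rw [ip_h1_E₃]; norm_num)
  refine ⟨g' * g, F4.mul_mem hg' hg, ?_⟩
  rw [LinearEquiv.mul_apply, h, h']

theorem exists_map_eq_E₂ {X : J1} (hX : X ∈ H') : ∃ g ∈ F4, g X = E₂ := by
  obtain ⟨hs, ht, hi⟩ := hX
  by_cases h₂ : 0 < ip X E₂
  · exact exists_mem_F4_of_ip_pos hs sharp_E₂ (ht.trans tr_E₂.symm) (by rw [ht]; norm_num) h₂
  have h₃ : 0 < ip X E₃ := by
    obtain ⟨ξ₁, ξ₂, ξ₃, x₁, x₂, x₃, rfl⟩ := exists_h1 X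
    rw [ip_h1_E₁] at hi
    rw [ip_h1_E₂] at h₂
    rw [ip_h1_E₃]
    rw [tr_h1] at ht
    linarith
  obtain ⟨g, hg, h⟩ := exists_mem_F4_of_ip_pos hs sharp_E₃ (ht.trans tr_E₃.symm)
    (by rw [ht]; norm_num) h₃
  obtain ⟨k, hk, h'⟩ := exists_map_E₂_eq_E₃
  refine ⟨k⁻¹ * g, F4.mul_mem (F4.inv_mem hk) hg, ?_⟩
  rw [LinearEquiv.mul_apply, h, ← h']
  exact k.symm_apply_apply E₂

/-- The trace form is positive on the Peirce space `J_0(E₁)`, but not on `J_0(E₂)`. -/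
theorem map_E₁_ne_E₂ {g : J1 ≃ₗ[ℝ] J1} (hg : g ∈ F4) : g E₁ ≠ E₂ := by
  intro h
  have hX : jordan E₂ (h1 0 0 0 0 1 0) = 0 := by
    rw [E₂, jordan_h1, ← h1_zero, h1_inj]
    simp [dot_zero_left, conj_zero]
  obtain ⟨Y, hY⟩ := g.surjective (h1 0 0 0 0 1 0)
  rw [← hY, ← h, ← map_jordan hg, ← map_zero g] at hX
  have hi := ip_map hg Y Y
  rw [hY, ip_h1] at hi
  have hX' := g.injective hX
  obtain ⟨ξ₁, ξ₂, ξ₃, x₁, x₂, x₃, rfl⟩ := exists_h1 Y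
  rw [E₁, jordan_h1, ← h1_zero, h1_inj] at hX'
  simp only [dot_zero_left, zero_mul, mul_zero, conj_zero, smul_zero] at hX'
  obtain ⟨e1, -, -, -, e2, e3⟩ := hX'
  have hx₂ : x₂ = 0 := by linear_combination (norm := module) (2 : ℝ) • e2
  have hx₃ : x₃ = 0 := by linear_combination (norm := module) (2 : ℝ) • e3
  subst hx₂ hx₃
  rw [ip_h1] at hi
  simp only [dot_zero_left, dot_one_one] at hi
  nlinarith [dot_self_nonneg x₁]

theorem map_E₁_mem_H {g : J1 ≃ₗ[ℝ] J1} (hg : g ∈ F4) : g E₁ ∈ H := by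
  have hs : cross (g E₁) (g E₁) = 0 := by rw [cross_map hg, sharp_E₁, map_zero]
  have ht : tr (g E₁) = 1 := by rw [tr_map hg, tr_E₁]
  refine ⟨hs, ht, one_le_ip_E₁_of_pos hs ht (lt_of_not_ge fun hle => ?_)⟩
  obtain ⟨k, hk, h⟩ := exists_map_eq_E₂ ⟨hs, ht, hle⟩
  exact map_E₁_ne_E₂ (F4.mul_mem hk hg) h

theorem map_E₂_mem_H' {g : J1 ≃ₗ[ℝ] J1} (hg : g ∈ F4) : g E₂ ∈ H' := by
  have hs : cross (g E₂) (g E₂) = 0 := by rw [cross_map hg, sharp_E₂, map_zero]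
  have ht : tr (g E₂) = 1 := by rw [tr_map hg, tr_E₂]
  refine ⟨hs, ht, le_of_not_gt fun hlt => ?_⟩
  obtain ⟨k, hk, h⟩ := exists_map_eq_E₁ ⟨hs, ht, one_le_ip_E₁_of_pos hs ht hlt⟩
  have h' : (k * g).symm E₁ = E₂ := by
    rw [LinearEquiv.symm_apply_eq]; exact h.symm
  exact map_E₁_ne_E₂ (F4.inv_mem (F4.mul_mem hk hg)) h'

theorem H_eq : H = Orb E₁ := by
  ext X
  constructor
  · intro hX
    obtain ⟨g, hg, h⟩ := exists_map_eq_E₁ hX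
    exact mem_Orb_of_map_eq hg h
  · rintro ⟨g, hg, rfl⟩
    exact map_E₁_mem_H hg

theorem H'_eq : H' = Orb E₂ := by
  ext X
  constructor
  · intro hX
    obtain ⟨g, hg, h⟩ := exists_map_eq_E₂ hX
    exact mem_Orb_of_map_eq hg h
  · rintro ⟨g, hg, rfl⟩
    exact map_E₂_mem_H' hg

theorem Orb_E₂_eq_Orb_E₃ : Orb E₂ = Orb E₃ := by
  obtain ⟨g, hg, h⟩ := exists_map_E₂_eq_E₃
  exact Orb_eq_of_map_eq hg h

theorem eq_zero_of_ip_E₁_eq_zero {X : J1} (hX : cross X X = 0) (ht : tr X = 0)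
    (h : ip X E₁ = 0) : X = 0 := by
  obtain ⟨ξ₁, ξ₂, ξ₃, x₁, x₂, x₃, rfl⟩ := exists_h1 X
  rw [ip_h1_E₁] at h
  subst h
  obtain ⟨h₁, h₂, h₃, -⟩ := sharp_h1_eq_zero_iff.1 hX
  rw [tr_h1] at ht
  have hx₂ : x₂ = 0 := eq_zero_of_dot_self (by linarith)
  have hx₃ : x₃ = 0 := eq_zero_of_dot_self (by linarith)
  obtain rfl : ξ₃ = -ξ₂ := by linarith
  have hξ : ξ₂ = 0 := by nlinarith [dot_self_nonneg x₁]
  subst hx₂ hx₃ hξ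
  have hx₁ : x₁ = 0 := eq_zero_of_dot_self (by linarith)
  rw [hx₁, neg_zero, h1_zero]

theorem ip_ne_zero_of_mem_H {X Y : J1} (hY : Y ∈ H) (hX : cross X X = 0) (ht : tr X = 0)
    (h0 : X ≠ 0) : ip X Y ≠ 0 := by
  obtain ⟨g, hg, h⟩ := exists_map_eq_E₁ hY
  rw [← ip_map hg, h]
  intro h'
  refine h0 (g.injective ?_)
  rw [map_zero]
  exact eq_zero_of_ip_E₁_eq_zero (by rw [cross_map hg, hX, map_zero]) (by rw [tr_map hg, ht]) h'

/-- The pairing of a null element with the points of `ℋ(𝐎)` has constant sign: it does not vanish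
along the path that contracts `ℋ(𝐎)` to `E₁` (up to normalisation of the trace). -/
theorem ip_E₁_pos_of_ip_pos {X Y : J1} (hY : Y ∈ H) (hX : cross X X = 0) (ht : tr X = 0)
    (h : 0 < ip X Y) : 0 < ip X E₁ := by
  have h0 : X ≠ 0 := by
    rintro rfl
    rw [← zero_smul ℝ (0 : J1), ip_smul_left, zero_mul] at h
    exact h.false
  obtain ⟨ξ₁, ξ₂, ξ₃, x₁, x₂, x₃, rfl⟩ := exists_h1 Y
  obtain ⟨hYs, hYt, hYi⟩ := hY
  rw [ip_h1_E₁] at hYi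
  rw [tr_h1] at hYt
  obtain ⟨h₁, h₂, h₃, h₄, h₅, h₆⟩ := sharp_h1_eq_zero_iff.1 hYs
  let m : ℝ → J1 := fun s => h1 ξ₁ (s ^ 2 * ξ₂) (s ^ 2 * ξ₃) (s ^ 2 • x₁) (s • x₂) (s • x₃)
  have hm1 : m 1 = h1 ξ₁ ξ₂ ξ₃ x₁ x₂ x₃ := by simp [m]
  have hm0 : m 0 = ξ₁ • E₁ := by simp [m, E₁, h1_smul]
  have hms : ∀ s, cross (m s) (m s) = 0 := fun s => by
    simp only [m]
    rw [sharp_h1_eq_zero_iff]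
    simp only [dot_smul_left, dot_smul_right, smul_mul_eq, mul_smul_eq, conj_smul]
    refine ⟨by linear_combination s ^ 4 * h₁, by linear_combination s ^ 2 * h₂,
      by linear_combination s ^ 2 * h₃, ?_, ?_, ?_⟩
    · linear_combination (norm := module) s ^ 2 • h₄
    · linear_combination (norm := module) s ^ 3 • h₅
    · linear_combination (norm := module) s ^ 3 • h₆
  have hmt : ∀ s ∈ Set.Icc (0 : ℝ) 1, 0 < tr (m s) := fun s hs => by
    simp only [m]
    rw [tr_h1]
    have hs2 : 0 ≤ 1 - s ^ 2 := by nlinarith [hs.1, hs.2]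
    nlinarith [mul_nonneg (sub_nonneg.2 hYi) hs2]
  have hmne : ∀ s ∈ Set.Icc (0 : ℝ) 1, ip X (m s) ≠ 0 := fun s hs h => by
    have hpos := hmt s hs
    have hs' : cross ((tr (m s))⁻¹ • m s) ((tr (m s))⁻¹ • m s) = 0 := by
      rw [cross_smul_left, cross_smul_right, hms, smul_zero, smul_zero]
    have ht' : tr ((tr (m s))⁻¹ • m s) = 1 := by
      rw [tr_smul, inv_mul_cancel₀ hpos.ne']
    refine ip_ne_zero_of_mem_H ⟨hs', ht', one_le_ip_E₁_of_pos hs' ht' ?_⟩ hX ht h0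
      (by rw [ip_smul_right, h, mul_zero])
    rw [ip_smul_left, ip_h1_E₁]
    exact mul_pos (inv_pos.2 hpos) (by linarith)
  have hcont : Continuous fun s => ip X (m s) := by
    obtain ⟨η₁, η₂, η₃, y₁, y₂, y₃, rfl⟩ := exists_h1 X
    simp only [m, ip_h1, dot_smul_right]
    fun_prop
  by_contra hle
  obtain ⟨s, hs, hzero⟩ := intermediate_value_Icc zero_le_one hcont.continuousOn
    (show (0 : ℝ) ∈ Set.Icc (ip X (m 0)) (ip X (m 1)) by
      rw [hm1, hm0, ip_smul_right]
      exact ⟨by nlinarith, h.le⟩)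
  exact hmne s hs hzero

theorem ip_map_E₁_pos {g : J1 ≃ₗ[ℝ] J1} (hg : g ∈ F4) {X : J1} (hX : cross X X = 0)
    (ht : tr X = 0) (h : 0 < ip X E₁) : 0 < ip (g X) E₁ :=
  ip_E₁_pos_of_ip_pos (map_E₁_mem_H hg) (by rw [cross_map hg, hX, map_zero])
    (by rw [tr_map hg, ht]) (by rwa [ip_map hg])

theorem neg_Pminus : -Pminus = h1 1 (-1) 0 0 0 (-1) := by
  rw [Pminus, h1_neg]; simp

theorem sharp_Pplus : cross Pplus Pplus = 0 := by
  rw [Pplus, sharp_h1_eq_zero_iff]; simp [dot_zero_left, conj_zero, dot_one_one]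

theorem sharp_neg (X : J1) : cross (-X) (-X) = cross X X := by
  have h : -X = (-1 : ℝ) • X := by module
  rw [h, cross_smul_left, cross_smul_right]; module

theorem tr_neg (X : J1) : tr (-X) = -tr X := by
  have h : -X = (-1 : ℝ) • X := by module
  rw [h, tr_smul]; ring

theorem ip_neg_left (X Y : J1) : ip (-X) Y = -ip X Y := by
  have h : -X = (-1 : ℝ) • X := by module
  rw [h, ip_smul_left]; ring

theorem sharp_Pminus : cross Pminus Pminus = 0 := by
  rw [Pminus, sharp_h1_eq_zero_iff]; simp [dot_zero_left, conj_zero, dot_one_one]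

theorem tr_Pplus : tr Pplus = 0 := by rw [Pplus, tr_h1]; ring

theorem tr_Pminus : tr Pminus = 0 := by rw [Pminus, tr_h1]; ring

theorem ip_Pplus_E₁ : ip Pplus E₁ = 1 := by rw [Pplus, ip_h1_E₁]

theorem ip_Pminus_E₁ : ip Pminus E₁ = -1 := by rw [Pminus, ip_h1_E₁]

theorem exists_map_neg_Pminus_eq_Pplus : ∃ g ∈ F4, g (-Pminus) = Pplus := by
  refine exists_mem_F4_of_ip_pos (by rw [sharp_neg, sharp_Pminus]) sharp_Pplus
    (by rw [tr_neg, tr_Pminus, tr_Pplus, neg_zero]) (by rw [tr_neg, tr_Pminus, neg_zero]) ?_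
  rw [neg_Pminus, Pplus, ip_h1]
  simp [dot_zero_left, dot_neg_left, dot_one_one]
  norm_num

theorem exists_map_eq_Pplus {X : J1} (hX : X ∈ N1plus) : ∃ g ∈ F4, g X = Pplus := by
  obtain ⟨hs, ht, hi⟩ := hX
  by_cases h : 0 < ip X Pplus
  · exact exists_mem_F4_of_ip_pos hs sharp_Pplus (ht.trans tr_Pplus.symm) ht.ge h
  -- `(X|P⁺) + (X|-P⁻) = 2 (ξ₁ - ξ₂)` is positive, so one of the two reflections is available.
  have h' : 0 < ip X (-Pminus) := by
    obtain ⟨ξ₁, ξ₂, ξ₃, x₁, x₂, x₃, rfl⟩ := exists_h1 X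
    rw [ip_h1_E₁] at hi
    obtain ⟨-, -, h₃, -⟩ := sharp_h1_eq_zero_iff.1 hs
    rw [Pplus, ip_h1] at h
    rw [neg_Pminus, ip_h1]
    simp only [dot_zero_right, dot_neg_right] at h ⊢
    have : ξ₂ ≤ 0 := by nlinarith [dot_self_nonneg x₃]
    linarith
  obtain ⟨g, hg, e⟩ := exists_mem_F4_of_ip_pos hs (by rw [sharp_neg, sharp_Pminus])
    (by rw [ht, tr_neg, tr_Pminus, neg_zero]) ht.ge h'
  obtain ⟨k, hk, e'⟩ := exists_map_neg_Pminus_eq_Pplus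
  refine ⟨k * g, F4.mul_mem hk hg, ?_⟩
  rw [LinearEquiv.mul_apply, e, e']

theorem exists_map_eq_Pminus {X : J1} (hX : X ∈ N1minus) : ∃ g ∈ F4, g X = Pminus := by
  obtain ⟨hs, ht, hi⟩ := hX
  obtain ⟨g, hg, e⟩ := exists_map_eq_Pplus (X := -X)
    ⟨by rw [sharp_neg, hs], by rw [tr_neg, ht, neg_zero], by rw [ip_neg_left]; linarith⟩
  obtain ⟨k, hk, e'⟩ := exists_map_neg_Pminus_eq_Pplus
  refine ⟨k⁻¹ * g, F4.mul_mem (F4.inv_mem hk) hg, ?_⟩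
  rw [LinearEquiv.mul_apply, ← neg_inj, ← map_neg, ← map_neg, e, ← e']
  exact k.symm_apply_apply _

theorem N1plus_eq : N1plus = Orb Pplus := by
  ext X
  constructor
  · intro hX
    obtain ⟨g, hg, h⟩ := exists_map_eq_Pplus hX
    exact mem_Orb_of_map_eq hg h
  · rintro ⟨g, hg, rfl⟩
    exact ⟨by rw [cross_map hg, sharp_Pplus, map_zero], by rw [tr_map hg, tr_Pplus],
      ip_map_E₁_pos hg sharp_Pplus tr_Pplus (by rw [ip_Pplus_E₁]; norm_num)⟩

theorem N1minus_eq : N1minus = Orb Pminus := by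
  ext X
  constructor
  · intro hX
    obtain ⟨g, hg, h⟩ := exists_map_eq_Pminus hX
    exact mem_Orb_of_map_eq hg h
  · rintro ⟨g, hg, rfl⟩
    refine ⟨by rw [cross_map hg, sharp_Pminus, map_zero], by rw [tr_map hg, tr_Pminus], ?_⟩
    have h := ip_map_E₁_pos hg (X := -Pminus) (by rw [sharp_neg, sharp_Pminus])
      (by rw [tr_neg, tr_Pminus, neg_zero]) (by rw [ip_neg_left, ip_Pminus_E₁]; norm_num)
    rw [map_neg, ip_neg_left] at h
    linarith

/-! ### The null cone of rank two -/

namespace Octonion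

/-- A unit imaginary octonion orthogonal to a given octonion. -/
theorem exists_imaginary_unit (x : Octonion ℝ) :
    ∃ a : Octonion ℝ, conj a = -a ∧ dot a a = 1 ∧ dot a x = 0 := by
  by_cases h : x.coord 1 ^ 2 + x.coord 2 ^ 2 = 0
  · have h₁ : x.coord 1 = 0 := by nlinarith [sq_nonneg (x.coord 1), sq_nonneg (x.coord 2)]
    refine ⟨⟨fun i => if i = 1 then 1 else 0⟩, ?_, ?_, ?_⟩
    · apply ext_coords <;> simp [coord_conj]
    · simp [dot]
    · simp [dot, h₁]
  · have hpos : 0 < x.coord 1 ^ 2 + x.coord 2 ^ 2 := lt_of_le_of_ne (by positivity) (Ne.symm h)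
    obtain ⟨r, hr, hrr⟩ : ∃ r : ℝ, 0 < r ∧ x.coord 1 ^ 2 + x.coord 2 ^ 2 = r ^ 2 :=
      ⟨_, Real.sqrt_pos.2 hpos, (Real.sq_sqrt hpos.le).symm⟩
    refine ⟨⟨fun i => if i = 1 then x.coord 2 / r else if i = 2 then -x.coord 1 / r else 0⟩,
      ?_, ?_, ?_⟩
    · apply ext_coords <;> simp [coord_conj]
    · simp [dot, Fin.sum_univ_eight]
      field_simp
      linarith
    · simp [dot, Fin.sum_univ_eight]
      field_simp
      ring

theorem mul_mul_of_imaginary {a : Octonion ℝ} (ha : conj a = -a) (hn : dot a a = 1)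
    (x : Octonion ℝ) : a * (a * x) = -x := by
  have h := conj_mul_cancel a x
  rw [ha, hn, one_smul, neg_mul] at h
  exact neg_eq_iff_eq_neg.1 h

theorem mul_mul_of_imaginary' {a : Octonion ℝ} (ha : conj a = -a) (hn : dot a a = 1)
    (x : Octonion ℝ) : x * a * a = -x := by
  have h := mul_mul_conj_cancel a x
  rw [ha, hn, one_smul, mul_neg] at h
  exact neg_eq_iff_eq_neg.1 h

theorem dot_neg_mul_self {a : Octonion ℝ} (hn : dot a a = 1) (x : Octonion ℝ) :
    dot (-(a * x)) (-(a * x)) = dot x x := by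
  rw [dot_neg_left, dot_neg_right, neg_neg, dot_mul_self, hn, one_mul]

/-- Polarisation: an additive map that preserves the norm preserves the inner product. -/
theorem dot_map_of_dot_map_self {f : Octonion ℝ → Octonion ℝ} (hf : ∀ x y, f (x + y) = f x + f y)
    (h : ∀ x, dot (f x) (f x) = dot x x) (x y : Octonion ℝ) : dot (f x) (f y) = dot x y := by
  have h1 := h (x + y)
  rw [hf] at h1
  simp only [dot_add_left, dot_add_right, h, dot_comm (f y), dot_comm y] at h1
  linarith

end Octonion

/-- The linear map `h¹(ξ; x₁, x₂, x₃) ↦ h¹(ξ; ā x₁, x₂ a, a x₃ ā)`, written for an imaginary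
octonion `a`, so that `ā = -a`. -/
noncomputable def trialityMap (a : Octonion ℝ) : J1 →ₗ[ℝ] J1 where
  toFun X := h1 (coordsEquiv X (.inl 0)) (coordsEquiv X (.inl 1)) (coordsEquiv X (.inl 2))
    (-(a * ⟨fun k => coordsEquiv X (.inr (0, k))⟩)) (⟨fun k => coordsEquiv X (.inr (1, k))⟩ * a)
    (-(a * ⟨fun k => coordsEquiv X (.inr (2, k))⟩ * a))
  map_add' X Y := by
    obtain ⟨ξ₁, ξ₂, ξ₃, x₁, x₂, x₃, rfl⟩ := exists_h1 X
    obtain ⟨η₁, η₂, η₃, y₁, y₂, y₃, rfl⟩ := exists_h1 Y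
    rw [h1_add]
    simp only [coordsEquiv_h1, h1_add]
    change h1 _ _ _ (-(a * (x₁ + y₁))) ((x₂ + y₂) * a) (-(a * (x₃ + y₃) * a)) =
      h1 _ _ _ (-(a * x₁) + -(a * y₁)) (x₂ * a + y₂ * a) (-(a * x₃ * a) + -(a * y₃ * a))
    simp only [mul_add, add_mul, neg_add]
    rfl
  map_smul' r X := by
    obtain ⟨ξ₁, ξ₂, ξ₃, x₁, x₂, x₃, rfl⟩ := exists_h1 X
    rw [h1_smul, RingHom.id_apply]
    simp only [coordsEquiv_h1, h1_smul]
    change h1 _ _ _ (-(a * r • x₁)) (r • x₂ * a) (-(a * r • x₃ * a)) =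
      h1 _ _ _ (r • -(a * x₁)) (r • (x₂ * a)) (r • -(a * x₃ * a))
    simp only [smul_mul_eq, mul_smul_eq, smul_neg]
    rfl

theorem trialityMap_h1 (a : Octonion ℝ) (ξ₁ ξ₂ ξ₃ : ℝ) (x₁ x₂ x₃ : Octonion ℝ) :
    trialityMap a (h1 ξ₁ ξ₂ ξ₃ x₁ x₂ x₃) =
      h1 ξ₁ ξ₂ ξ₃ (-(a * x₁)) (x₂ * a) (-(a * x₃ * a)) := by
  change h1 _ _ _ _ _ _ = _
  rw [coordsEquiv_h1]
  rfl

section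

variable {a : Octonion ℝ} (ha : conj a = -a) (hn : dot a a = 1)

include ha hn

theorem trialityMap_neg_trialityMap (X : J1) : trialityMap (-a) (trialityMap a X) = X := by
  obtain ⟨ξ₁, ξ₂, ξ₃, x₁, x₂, x₃, rfl⟩ := exists_h1 X
  rw [trialityMap_h1, trialityMap_h1]
  simp only [neg_mul, mul_neg, neg_neg, ← mul_mul_self' a x₃, mul_mul_of_imaginary ha hn,
    mul_mul_of_imaginary' ha hn]

/-- The map `trialityMap a` is an automorphism, by the three Moufang identities. -/
theorem trialityMap_jordan (X Y : J1) :
    trialityMap a (jordan X Y) = jordan (trialityMap a X) (trialityMap a Y) := by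
  obtain ⟨ξ₁, ξ₂, ξ₃, x₁, x₂, x₃, rfl⟩ := exists_h1 X
  obtain ⟨η₁, η₂, η₃, y₁, y₂, y₃, rfl⟩ := exists_h1 Y
  have d₁ : ∀ x y, dot (-(a * x)) (-(a * y)) = dot x y :=
    dot_map_of_dot_map_self (fun x y => by rw [mul_add, neg_add]) (dot_neg_mul_self hn)
  have d₂ : ∀ x y, dot (x * a) (y * a) = dot x y :=
    dot_map_of_dot_map_self (fun x y => add_mul x y a) fun x => by rw [dot_mul_self, hn, mul_one]
  have d₃ : ∀ x y, dot (-(a * x * a)) (-(a * y * a)) = dot x y :=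
    dot_map_of_dot_map_self (fun x y => by rw [mul_add, add_mul, neg_add]) fun x => by
      rw [dot_neg_left, dot_neg_right, neg_neg, dot_mul_self, dot_mul_self, hn, one_mul, mul_one]
  have c₁ : ∀ x y, conj (x * a * -(a * y * a)) = -(a * conj (x * y)) := fun x y => by
    rw [mul_neg, ← right_moufang, mul_mul_of_imaginary' ha hn, neg_mul, neg_mul, neg_neg,
      Octonion.conj_mul (x * y), ha, neg_mul]
  have c₂ : ∀ x y, conj (-(a * x * a) * -(a * y)) = conj (x * y) * a := fun x y => by
    rw [neg_mul, mul_neg, neg_neg, ← left_moufang, mul_mul_of_imaginary ha hn, mul_neg, mul_neg,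
      conj_neg, Octonion.conj_mul a, ha, mul_neg, neg_neg]
  have c₃ : ∀ x y, conj (-(a * x) * (y * a)) = -(a * conj (x * y) * a) := fun x y => by
    have hd := dot_conj_conj a (x * y)
    rw [ha, dot_neg_left] at hd
    rw [neg_mul, middle_moufang, mul_mul_self, conj_neg, conj_sub, conj_smul, conj_smul, ha,
      conj_conj, ← hd]
    module
  rw [jordan_h1, trialityMap_h1, trialityMap_h1, trialityMap_h1, jordan_h1]
  simp only [d₁, d₂, d₃, c₁, c₂, c₃, h1_inj, true_and]
  refine ⟨?_, ?_, ?_⟩ <;>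
    simp only [mul_add, mul_sub, add_mul, smul_mul_eq, mul_smul_eq] <;> module

/-- `trialityMap a` for an imaginary unit `a`, as an element of the linear group. -/
noncomputable def triality : J1 ≃ₗ[ℝ] J1 :=
  LinearEquiv.ofLinearMap (trialityMap a) (trialityMap (-a))
    (LinearMap.ext fun X => by
      have h := trialityMap_neg_trialityMap (a := -a) (by rw [conj_neg, ha])
        (by rw [dot_neg_left, dot_neg_right, neg_neg, hn]) X
      rwa [neg_neg] at h)
    (LinearMap.ext (trialityMap_neg_trialityMap ha hn))

theorem triality_mem_F4 : triality ha hn ∈ F4 := trialityMap_jordan ha hn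

theorem triality_h1 (ξ₁ ξ₂ ξ₃ : ℝ) (x₁ x₂ x₃ : Octonion ℝ) :
    triality ha hn (h1 ξ₁ ξ₂ ξ₃ x₁ x₂ x₃) =
      h1 ξ₁ ξ₂ ξ₃ (-(a * x₁)) (x₂ * a) (-(a * x₃ * a)) :=
  trialityMap_h1 a _ _ _ _ _ _

/-- The stabiliser of `P⁻` moves `Q⁺(x) + r P⁻` to `Q⁺(ā x) + r P⁻`. -/
theorem triality_Qplus_add (r : ℝ) (x : Octonion ℝ) :
    triality ha hn (Qplus x + r • Pminus) = Qplus (-(a * x)) + r • Pminus := by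
  simp only [Qplus, Pminus, h1_smul, h1_add, triality_h1]
  rw [h1_inj]
  refine ⟨rfl, rfl, rfl, ?_, ?_, ?_⟩
  · simp
  · rw [conj_neg, Octonion.conj_mul, ha]; simp
  · have := mul_mul_of_imaginary' ha hn 1
    rw [one_mul] at this
    simp [mul_smul_eq, smul_mul_eq, this]

end

theorem exists_map_Qplus_eq (r : ℝ) {x : Octonion ℝ} (hx : dot x x = 1) :
    ∃ g ∈ F4, g (Qplus x + r • Pminus) = Qplus 1 + r • Pminus := by
  -- A unit octonion is a product of two imaginary units: `b = ā x` is imaginary for `a ⊥ x`.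
  obtain ⟨a, ha, hn, hax⟩ := exists_imaginary_unit x
  have hb : conj (-(a * x)) = -(-(a * x)) := by
    have h := conj_mul_add a x
    rw [hax, mul_zero, zero_smul, ha, neg_mul] at h
    rw [conj_neg, Octonion.conj_mul, ha, mul_neg, neg_neg, neg_neg]
    rw [add_comm, add_neg_eq_zero] at h
    exact h
  have hbn : dot (-(a * x)) (-(a * x)) = 1 := (dot_neg_mul_self hn x).trans hx
  refine ⟨triality hb hbn * triality ha hn,
    F4.mul_mem (triality_mem_F4 _ _) (triality_mem_F4 _ _), ?_⟩
  rw [LinearEquiv.mul_apply, triality_Qplus_add, triality_Qplus_add]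
  have h := conj_mul_self (-(a * x))
  rw [hb, hbn, one_smul, neg_mul] at h
  rw [h]

theorem sharp_Qplus (x : Octonion ℝ) : cross (Qplus x) (Qplus x) = dot x x • Pminus := by
  rw [Qplus, Pminus, sharp_h1, h1_smul, h1_inj]
  simp [dot_conj_conj, mul_conj_self, conj_zero, dot_zero_left, conj_smul, conj_one]

theorem tr_Qplus (x : Octonion ℝ) : tr (Qplus x) = 0 := by
  rw [Qplus, tr_h1]; simp

theorem det_Qplus (x : Octonion ℝ) : det (Qplus x) = 0 := by
  rw [Qplus, det_h1]; simp [conj_zero, dot_zero_left]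

/-- The reflection of the idempotent `E₃ + s Q⁺(1) + s² P⁻` fixes `P⁻` and moves `Q⁺(1) + 4 s P⁻`
to `-Q⁺(1)`. -/
theorem exists_map_Qplus_add_eq_neg (r : ℝ) :
    ∃ g ∈ F4, g (Qplus 1 + r • Pminus) = -Qplus 1 := by
  obtain ⟨s, rfl⟩ : ∃ s, r = 4 * s := ⟨r / 4, by ring⟩
  have hM : E₃ + s • Qplus 1 + s ^ 2 • Pminus =
      h1 (-s ^ 2) (s ^ 2) 1 (s • 1) (s • 1) (s ^ 2 • 1) := by
    simp only [E₃, Qplus, Pminus, h1_smul, h1_add, h1_inj, conj_one]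
    simp
  have hs : cross (E₃ + s • Qplus 1 + s ^ 2 • Pminus) (E₃ + s • Qplus 1 + s ^ 2 • Pminus) = 0 := by
    rw [hM, sharp_h1_eq_zero_iff]
    simp only [dot_smul_left, dot_smul_right, dot_one_one, smul_mul_eq, mul_smul_eq, conj_smul,
      conj_one, one_mul]
    refine ⟨by ring, by ring, by ring, by module, by module, by module⟩
  have ht : tr (E₃ + s • Qplus 1 + s ^ 2 • Pminus) = 1 := by
    rw [hM, tr_h1]; ring
  refine ⟨reflection _ hs ht, reflection_mem_F4 _ _, ?_⟩
  rw [reflection_apply, hM]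
  simp only [Qplus, Pminus, h1_smul, h1_add, jordan_h1, ip_h1, h1_sub, h1_neg, h1_inj]
  simp only [dot_smul_left, dot_smul_right, dot_one_one, mul_smul_eq, conj_smul, conj_one, one_mul,
    mul_one, zero_add, add_zero, mul_zero, smul_zero]
  refine ⟨by ring, by ring, by ring, by module, by module, by module⟩

theorem exists_map_neg_Qplus_eq : ∃ g ∈ F4, g (-Qplus 1) = Qplus 1 := by
  obtain ⟨g, hg, h⟩ := exists_map_Qplus_add_eq_neg 0
  rw [zero_smul, add_zero] at h
  exact ⟨g, hg, by rw [map_neg, h, neg_neg]⟩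

/-- If `X^{×2}` is `P⁺` (the case `t = 1`) or `P⁻` (the case `t = -1`) and `tr X = det X = 0`, then
it is `P⁻`, and `X` is known up to a unit octonion and a real number. -/
theorem eq_Qplus_add_of_sharp_eq {t : ℝ} (ht : t ^ 2 = 1) {X : J1} (htr : tr X = 0)
    (hdet : det X = 0) (hs : cross X X = h1 t (-t) 0 0 0 1) :
    t = -1 ∧ ∃ (x : Octonion ℝ) (r : ℝ), dot x x = 1 ∧ X = Qplus x + r • Pminus := by
  have hj := jordan_sharp X
  rw [hdet, zero_smul, hs] at hj
  obtain ⟨ξ₁, ξ₂, ξ₃, x₁, x₂, x₃, rfl⟩ := exists_h1 X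
  rw [tr_h1] at htr
  rw [sharp_h1, h1_inj] at hs
  rw [jordan_h1, ← h1_zero, h1_inj] at hj
  simp only [dot_zero_right, dot_one_right, mul_zero, sub_zero, add_zero] at hj
  obtain ⟨s₁, s₂, s₃, -, -, s₆⟩ := hs
  obtain ⟨j₁, j₂, -⟩ := hj
  have hξ₂ : ξ₂ = -ξ₁ := by
    linear_combination t * (-j₂ + j₁) - (ξ₂ + ξ₁) * ht
  have hξ₃ : ξ₃ = 0 := by linarith
  subst hξ₂ hξ₃
  have ht' : t = -1 := by
    rcases mul_eq_zero.1 (show (t - 1) * (t + 1) = 0 by linear_combination ht) with h | h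
    · linarith [dot_self_nonneg x₁]
    · linarith
  subst ht'
  have hn : dot x₁ x₁ = 1 := by linarith
  refine ⟨rfl, x₁, -ξ₁, hn, ?_⟩
  have hx₂ : x₂ = conj x₁ := by
    have h := congrArg conj s₆
    rw [zero_smul, sub_zero, conj_conj, conj_one] at h
    have h' := conj_mul_cancel x₁ x₂
    rw [h, mul_one, hn, one_smul] at h'
    exact h'.symm
  have hx₃ : x₃ + ξ₁ • 1 = 0 := eq_zero_of_dot_self <| by
    simp only [dot_add_left, dot_add_right, dot_smul_left, dot_smul_right, dot_comm 1 x₃,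
      dot_one_one]
    rw [dot_one_right]
    linear_combination s₃ - 2 * ξ₁ * j₁
  simp only [Qplus, Pminus, h1_smul, h1_add, h1_inj]
  refine ⟨by ring, by ring, by ring, by simp, by simp [hx₂], ?_⟩
  linear_combination (norm := module) hx₃

theorem N2_eq : N2 = Orb (Qplus 1) := by
  ext X
  constructor
  · rintro ⟨ht, hts, hd, hne⟩
    have hss : cross (cross X X) (cross X X) = 0 := by rw [sharp_sharp, hd, zero_smul]
    obtain ⟨t, htt, g, hg, h⟩ : ∃ t : ℝ, t ^ 2 = 1 ∧ ∃ g ∈ F4, g (cross X X) =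
        h1 t (-t) 0 0 0 1 := by
      rcases lt_trichotomy (ip (cross X X) E₁) 0 with h | h | h
      · obtain ⟨g, hg, e⟩ := exists_map_eq_Pminus ⟨hss, hts, h⟩
        exact ⟨-1, by norm_num, g, hg, by rw [e, Pminus, neg_neg]⟩
      · exact absurd (eq_zero_of_ip_E₁_eq_zero hss hts h) hne
      · obtain ⟨g, hg, e⟩ := exists_map_eq_Pplus ⟨hss, hts, h⟩
        exact ⟨1, by norm_num, g, hg, by rw [e, Pplus]⟩
    obtain ⟨-, x, r, hx, e⟩ := eq_Qplus_add_of_sharp_eq htt (X := g X) (by rw [tr_map hg, ht])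
      (by rw [det_map hg, hd]) (by rw [cross_map hg, h])
    obtain ⟨g₁, hg₁, e₁⟩ := exists_map_Qplus_eq r hx
    obtain ⟨g₂, hg₂, e₂⟩ := exists_map_Qplus_add_eq_neg r
    obtain ⟨g₃, hg₃, e₃⟩ := exists_map_neg_Qplus_eq
    refine mem_Orb_of_map_eq (F4.mul_mem hg₃ (F4.mul_mem hg₂ (F4.mul_mem hg₁ hg))) ?_
    simp only [LinearEquiv.mul_apply, e, e₁, e₂, e₃]
  · rintro ⟨g, hg, rfl⟩
    have hs := sharp_Qplus 1
    rw [dot_one_one, one_smul] at hs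
    refine ⟨by rw [tr_map hg, tr_Qplus], by rw [cross_map hg, tr_map hg, hs, tr_Pminus],
      by rw [det_map hg, det_Qplus], ?_⟩
    rw [cross_map hg, hs, Ne, map_eq_zero_iff g g.injective]
    intro h
    have := ip_Pminus_E₁
    rw [h, ← zero_smul ℝ (0 : J1), ip_smul_left] at this
    norm_num at this

end ExcJordan

theorem proposition0p1 :
    ExcJordan.H = ExcJordan.Orb ExcJordan.E₁ ∧
    (ExcJordan.H' = ExcJordan.Orb ExcJordan.E₂ ∧
      ExcJordan.Orb ExcJordan.E₂ = ExcJordan.Orb ExcJordan.E₃) ∧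
    ExcJordan.N1plus = ExcJordan.Orb ExcJordan.Pplus ∧
    ExcJordan.N1minus = ExcJordan.Orb ExcJordan.Pminus ∧
    ExcJordan.N2 = ExcJordan.Orb (ExcJordan.Qplus 1) :=
  ⟨ExcJordan.H_eq, ⟨ExcJordan.H'_eq, ExcJordan.Orb_E₂_eq_Orb_E₃⟩, ExcJordan.N1plus_eq,
    ExcJordan.N1minus_eq, ExcJordan.N2_eq⟩
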